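/- Work in the complex projective plane $\mathbb{P}^2$. Let $d>3$ and let $\mathcal{F}_d$ be the Fermat curve $x^d+y^d+z^d=0$. Write $(\mathcal C.\Gamma)_p$ for the intersection multiplicity of two plane curves at $p$. The tangent line to $\mathcal{F}_d$ at $p\in\mathcal{F}_d$ is the line $T_p$ with $(\mathcal{F}_d.T_p)_p\ge 2$, and $p$ is an inflection point if $(\mathcal{F}_d.T_p)_p\ge 3$. A sextactic point of $\mathcal{F}_d$ is a point $p\in\mathcal{F}_d$ that is not an inflection point and for which there is a conic $O_p$ with $(\mathcal{F}_d.O_p)_p\ge 6$; such a conic is called the hyperosculating conic at $p$. A point $q$ is an $m$-fold point of a union of plane curves if the reduced curve supported on that union has multiplicity $m$ at $q$. Let $S$ be any set of $d$ distinct sextactic points of $\mathcal{F}_d$ that lie on a common line. Then at each $s\in S$ the tangent line $T_s$ and the hyperosculating conic $O_s$ exist and are unique, and: 1. the intersection $\bigcap_{s\in S}T_s$ consists of exactly one point, and this point is a $d$-fold point of $\bigcup_{s\in S}T_s$; 2. the intersection $\bigcap_{s\in S}O_s$ consists of exactly two points, and each of them is a $d$-fold point of $\bigcup_{s\in S}O_s$.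 -/

import Mathlib

open MvPolynomial
open scoped LinearAlgebra.Projectivization

noncomputable section

namespace FermatOsculation

/-- The complex projective plane. -/
abbrev P2 : Type := ℙ ℂ (Fin 3 → ℂ)

/-- A (possibly non-reduced) plane curve of degree `n`: a nonzero ternary form of degree `n`,
up to nonzero scalars. In particular `PlaneCurve 1` is the set of lines and `PlaneCurve 2` the set
of (possibly degenerate) conics. -/
abbrev PlaneCurve (n : ℕ) : Type := ℙ ℂ (homogeneousSubmodule (Fin 3) ℂ n)

/-- A defining form of a plane curve (well defined up to a nonzero scalar). -/
def PlaneCurve.form {n : ℕ} (C : PlaneCurve n) : MvPolynomial (Fin 3) ℂ :=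
  (Projectivization.rep C : homogeneousSubmodule (Fin 3) ℂ n)

/-- The set of points of a plane curve. -/
def PlaneCurve.points {n : ℕ} (C : PlaneCurve n) : Set P2 :=
  {p | eval p.rep C.form = 0}

theorem exists_rep_ne_zero (p : P2) : ∃ i : Fin 3, p.rep i ≠ 0 :=
  Function.ne_iff.mp p.rep_nonzero

/-- The index of some nonvanishing homogeneous coordinate of `p`. The plane `x_i = p_i` in affine
three-space is then an affine chart of the projective plane around `p`. -/
def chart (p : P2) : Fin 3 := Classical.choose (exists_rep_ne_zero p)

theorem chart_spec (p : P2) : p.rep (chart p) ≠ 0 := Classical.choose_spec (exists_rep_ne_zero p)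

/-- The local ring of affine three-space at the point `v`: the fractions `f / g` of polynomials
with `g v ≠ 0`. -/
abbrev AffineLocalRing (v : Fin 3 → ℂ) : Type :=
  Localization ((nonZeroDivisors ℂ).comap (eval v : MvPolynomial (Fin 3) ℂ →+* ℂ))

/-- The intersection multiplicity `(Γ . Δ)_p = dim_ℂ 𝒪_p / (F, G)`, where `𝒪_p` is the local ring
of the projective plane at `p` and `F = 0`, `G = 0` are local equations of `Γ` and `Δ`. With
`v` a representative of `p` and `v_i ≠ 0`, the ring `𝒪_p` is the local ring at `v` of the affine
chart `x_i = v_i`, that is, the quotient by `x_i - v_i` of the local ring of affine three-space at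
`v`. The value is `⊤` exactly when `Γ` and `Δ` share a component through `p`. -/
def intersectionMultiplicity {m n : ℕ} (Γ : PlaneCurve m) (Δ : PlaneCurve n) (p : P2) : ℕ∞ :=
  Module.length ℂ (AffineLocalRing p.rep ⧸
    Ideal.map (algebraMap (MvPolynomial (Fin 3) ℂ) (AffineLocalRing p.rep))
      (Ideal.span {Γ.form, Δ.form, X (chart p) - C (p.rep (chart p))}))

/-- The multiplicity of the curve `Γ` at the point `p`: the order of the Taylor expansion at `p` of
the equation of `Γ` in the affine chart `x_i = p_i` around `p`. -/
def multiplicityAt {n : ℕ} (Γ : PlaneCurve n) (p : P2) : ℕ∞ :=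
  MvPowerSeries.order
    ((aeval (fun j : Fin 3 => if j = chart p then C (p.rep j) else X j + C (p.rep j)) Γ.form :
      MvPolynomial (Fin 3) ℂ) : MvPowerSeries (Fin 3) ℂ)

/-- `p` is a smooth point of `Γ`. -/
def IsSmoothPoint {n : ℕ} (Γ : PlaneCurve n) (p : P2) : Prop := multiplicityAt Γ p = 1

/-- `p` is an `m`-fold point of the set `Z`, viewed as a reduced plane curve. -/
def IsFoldPoint (m : ℕ) (Z : Set P2) (p : P2) : Prop :=
  ∃ (k : ℕ) (Γ : PlaneCurve k), Squarefree Γ.form ∧ Γ.points = Z ∧ multiplicityAt Γ p = m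

/-- `Γ` is an osculating curve of degree `n` to `C` at `p`. -/
def IsOsculating {m n : ℕ} (C : PlaneCurve m) (p : P2) (Γ : PlaneCurve n) : Prop :=
  ((n * (n + 3) / 2 : ℕ) : ℕ∞) ≤ intersectionMultiplicity C Γ p

/-- `Γ` is a hyperosculating curve of degree `n` to `C` at `p`. -/
def IsHyperosculating {m n : ℕ} (C : PlaneCurve m) (p : P2) (Γ : PlaneCurve n) : Prop :=
  ((n * (n + 3) / 2 : ℕ) : ℕ∞) < intersectionMultiplicity C Γ p

/-- Tangent lines are the osculating curves of degree one: `(C . T)_p ≥ 2`. -/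
abbrev IsTangentLine {m : ℕ} (C : PlaneCurve m) (p : P2) (T : PlaneCurve 1) : Prop :=
  IsOsculating C p T

/-- Hyperosculating conics: `(C . O)_p ≥ 6`. -/
abbrev IsHyperosculatingConic {m : ℕ} (C : PlaneCurve m) (p : P2) (O : PlaneCurve 2) : Prop :=
  IsHyperosculating C p O

/-- Inflection points: smooth points with a tangent line such that `(C . T)_p ≥ 3`. -/
def IsInflectionPoint {m : ℕ} (C : PlaneCurve m) (p : P2) : Prop :=
  IsSmoothPoint C p ∧ ∃ T : PlaneCurve 1, IsHyperosculating C p T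

/-- Sextactic points: smooth points, not inflection points, with a hyperosculating conic. -/
def IsSextacticPoint {m : ℕ} (C : PlaneCurve m) (p : P2) : Prop :=
  IsSmoothPoint C p ∧ ¬ IsInflectionPoint C p ∧ ∃ O : PlaneCurve 2, IsHyperosculatingConic C p O

/-- The form `x^d + y^d + z^d`. -/
def fermatForm (d : ℕ) : homogeneousSubmodule (Fin 3) ℂ d :=
  ⟨X 0 ^ d + X 1 ^ d + X 2 ^ d, by
    rw [mem_homogeneousSubmodule]
    exact ((isHomogeneous_X_pow 0 d).add (isHomogeneous_X_pow 1 d)).add (isHomogeneous_X_pow 2 d)⟩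

theorem fermatForm_ne_zero (d : ℕ) : fermatForm d ≠ 0 := by
  intro h
  have h1 : (X 0 ^ d + X 1 ^ d + X 2 ^ d : MvPolynomial (Fin 3) ℂ) = 0 := congrArg Subtype.val h
  have h2 := congrArg (eval (fun _ : Fin 3 => (1 : ℂ))) h1
  norm_num at h2

/-- The Fermat curve `x^d + y^d + z^d = 0`. -/
def fermatCurve (d : ℕ) : PlaneCurve d := Projectivization.mk ℂ (fermatForm d) (fermatForm_ne_zero d)

end FermatOsculation

end

/-! Contact with the Fermat curve at a point `v` off the coordinate triangle is read off a
parametrized branch. If `∑ v_j ^ d * ρ_j = 0`, the series `v_j (1 + ρ_j t) ^ (1 / d)` satisfy the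
equation of the curve identically, because their `d`-th powers are linear in `t`. An intersection
multiplicity is at least `k` exactly when the other form, evaluated along the branch, is divisible
by `t ^ k` (`le_intersectionMultiplicity_iff_fermatBranch`).

For a conic, contact of order six is a system of six linear equations in its six coefficients.
Choose weights with `∑ ρ_j = 0`. In terms of moments of the coefficients the system can be solved by
hand (`conic_moments`, `moments_reduce`, `moments_eq_zero`): for distinct weights whose product is
nonzero it has only the zero solution. Hence at a sextactic point two of `x ^ d`, `y ^ d`, `z ^ d`
agree, the third being `-2` times their common value. There the solution is unique up to scaling and
gives the explicit conic `sextacticForm`. Points on the coordinate lines are inflection points, so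
they do not occur.

The global step is that a line with `d` sextactic points passes through a vertex of the coordinate
triangle (`exists_coeff_eq_zero`). On any other line, the points whose exceptional coordinate is
fixed correspond to points common to two circles with different centres, so there are at most two of
them and `d ≤ 6`. For `d = 5, 6`, comparing two pairs of points makes `4 ^ (1 / d)` a ratio of
products of squared distances `|1 - ζ| ^ 2` between `d`-th roots of unity, which a list of the
possible values excludes. For `d = 4`, a relation over the Gaussian integers would make `√2`
rational.

On a line `y = t x` every coordinate to the power `d` is a fixed multiple of `x ^ d`, so all points
share a type and differ only in `μ = x / z`. The tangents become `a x + b y + μ c z = 0`, and the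
conics become `q(x, y) + μ l(x, y) z + μ² c z² = 0`. Three values of `μ` force a common point of the
conics onto `z = 0`, where `q` has two simple zeros; two values suffice for the lines. All members
are irreducible, distinct and smooth at these base points, so each contributes one to the
multiplicity of the union (`line_pencil`, `conic_pencil`). -/

namespace FermatOsculation

/-! ### Colength and order of vanishing along a formal branch -/

section LocalAlgebra

variable {O : Type*} [CommRing O] [Algebra ℂ O]

/-- Membership in `J + (u ^ k)` is detected by the order of vanishing along a branch. -/
theorem mem_sup_span_pow_iff (J : Ideal O) (u : O) (ψ : O →ₐ[ℂ] PowerSeries ℂ) (N : ℕ)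
    (hJ : ∀ a ∈ J, PowerSeries.X ^ N ∣ ψ a)
    (hu : ∀ a : O, ∃ c : ℂ, a - algebraMap ℂ O c ∈ J ⊔ Ideal.span {u})
    (w : PowerSeries ℂ) (hw : ψ u = PowerSeries.X * w) (hw0 : PowerSeries.constantCoeff w ≠ 0)
    (k : ℕ) (hk : k ≤ N) (a : O) :
    a ∈ J ⊔ Ideal.span {u ^ k} ↔ PowerSeries.X ^ k ∣ ψ a := by
  have key : ∀ k ≤ N, ∀ a ∈ J ⊔ Ideal.span {u ^ k}, PowerSeries.X ^ k ∣ ψ a := by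
    intro k hk a ha
    obtain ⟨j, hj, b, hb, rfl⟩ := Submodule.mem_sup.1 ha
    obtain ⟨c, rfl⟩ := Ideal.mem_span_singleton.1 hb
    rw [map_add, map_mul, map_pow, hw, mul_pow, mul_assoc]
    exact dvd_add ((pow_dvd_pow _ hk).trans (hJ j hj)) (dvd_mul_right _ _)
  refine ⟨key k hk a, fun h => ?_⟩
  induction k with
  | zero => simp
  | succ k ih =>
    obtain ⟨j, hj, b, hb, rfl⟩ :=
      Submodule.mem_sup.1 (ih (by omega) ((pow_dvd_pow _ (Nat.le_succ k)).trans h))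
    obtain ⟨b, rfl⟩ := Ideal.mem_span_singleton.1 hb
    obtain ⟨c, hc⟩ := hu b
    obtain ⟨j', hj', e, he, hje⟩ := Submodule.mem_sup.1 hc
    obtain ⟨e, rfl⟩ := Ideal.mem_span_singleton.1 he
    have hb' : b = algebraMap ℂ O c + j' + u * e := by linear_combination -hje
    -- Modulo `J + (u ^ (k + 1))` the element is `c * u ^ k`. Since `ψ u` has order exactly one,
    -- divisibility of the image by `X ^ (k + 1)` forces `c = 0`.
    have hmem : j + u ^ k * b - algebraMap ℂ O c * u ^ k ∈ J ⊔ Ideal.span {u ^ (k + 1)} := by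
      have : j + u ^ k * b - algebraMap ℂ O c * u ^ k = (j + u ^ k * j') + u ^ (k + 1) * e := by
        rw [hb']; ring
      rw [this]
      exact Submodule.add_mem_sup (J.add_mem hj (J.mul_mem_left _ hj'))
        (Ideal.mul_mem_right _ _ (Ideal.mem_span_singleton_self _))
    have hdvd : PowerSeries.X ^ (k + 1) ∣ ψ (algebraMap ℂ O c * u ^ k) := by
      have := dvd_sub h (key (k + 1) hk _ hmem)
      rwa [← map_sub, sub_sub_cancel] at this
    have hc0 : c = 0 := by
      rw [PowerSeries.X_pow_dvd_iff] at hdvd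
      have := hdvd k (Nat.lt_succ_self k)
      rw [map_mul, map_pow, hw, AlgHom.commutes, mul_pow, ← mul_assoc, mul_comm (algebraMap _ _ c),
        mul_assoc, PowerSeries.coeff_X_pow_mul', if_pos le_rfl, Nat.sub_self,
        PowerSeries.coeff_zero_eq_constantCoeff_apply, map_mul, map_pow] at this
      have h2 : PowerSeries.constantCoeff (algebraMap ℂ (PowerSeries ℂ) c) = c := by simp
      rw [h2] at this
      exact (mul_eq_zero.1 this).resolve_right (pow_ne_zero _ hw0)
    simpa [hc0] using hmem

/-- The first `k` coefficients of `ψ a` identify the quotient with `ℂ ^ k`. The kernel is given by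
`mem_sup_span_pow_iff`, and surjectivity holds because the powers of `ψ u`, having orders `0, 1, 2,
...`, allow a series to be matched one coefficient at a time. -/
theorem length_quotient_sup_span_pow (J : Ideal O) (u : O) (ψ : O →ₐ[ℂ] PowerSeries ℂ) (N : ℕ)
    (hJ : ∀ a ∈ J, PowerSeries.X ^ N ∣ ψ a)
    (hu : ∀ a : O, ∃ c : ℂ, a - algebraMap ℂ O c ∈ J ⊔ Ideal.span {u})
    (w : PowerSeries ℂ) (hw : ψ u = PowerSeries.X * w) (hw0 : PowerSeries.constantCoeff w ≠ 0)
    (k : ℕ) (hk : k ≤ N) :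
    Module.length ℂ (O ⧸ (J ⊔ Ideal.span {u ^ k})) = k := by
  have hsurj : ∀ (f : PowerSeries ℂ), ∃ a : O, PowerSeries.X ^ k ∣ f - ψ a := by
    intro f
    clear hk
    induction k with
    | zero => exact ⟨0, by simp⟩
    | succ k ih =>
      obtain ⟨a, h, hh⟩ := ih
      refine ⟨a + algebraMap ℂ O (PowerSeries.constantCoeff h / PowerSeries.constantCoeff w ^ k)
        * u ^ k, ?_⟩
      have : f - ψ (a + algebraMap ℂ O (PowerSeries.constantCoeff h /
          PowerSeries.constantCoeff w ^ k) * u ^ k) = PowerSeries.X ^ k *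
          (h - algebraMap ℂ _ (PowerSeries.constantCoeff h / PowerSeries.constantCoeff w ^ k)
            * w ^ k) := by
        rw [map_add, map_mul, map_pow, hw, AlgHom.commutes, ← sub_sub, hh]; ring
      rw [this, pow_succ]
      refine mul_dvd_mul_left _ (PowerSeries.X_dvd_iff.2 ?_)
      simp [hw0]
  let T : O →ₗ[ℂ] (Fin k → ℂ) :=
    LinearMap.pi fun i => (PowerSeries.coeff (R := ℂ) (i : ℕ)) ∘ₗ ψ.toLinearMap
  have hT : ∀ a i, T a i = PowerSeries.coeff (i : ℕ) (ψ a) := fun a i => rfl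
  have hker : LinearMap.ker T = (J ⊔ Ideal.span {u ^ k}).restrictScalars ℂ := by
    ext a
    rw [LinearMap.mem_ker, Submodule.restrictScalars_mem,
      mem_sup_span_pow_iff J u ψ N hJ hu w hw hw0 k hk, PowerSeries.X_pow_dvd_iff]
    constructor
    · intro h m hm
      have := congrFun h ⟨m, hm⟩
      simpa [hT] using this
    · intro h
      ext i
      simpa [hT] using h i i.2
  have hTs : Function.Surjective T := by
    intro y
    obtain ⟨a, ha⟩ := hsurj (PowerSeries.mk fun n => if h : n < k then y ⟨n, h⟩ else 0)
    refine ⟨a, ?_⟩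
    ext i
    rw [PowerSeries.X_pow_dvd_iff] at ha
    have := ha i i.2
    rw [map_sub, PowerSeries.coeff_mk, dif_pos i.2, sub_eq_zero] at this
    rw [hT, ← this]
  have e1 := LinearMap.quotKerEquivOfSurjective T hTs
  have e2 := (Submodule.quotEquivOfEq _ _ hker).symm.trans e1
  have e3 := (Submodule.Quotient.restrictScalarsEquiv ℂ (J ⊔ Ideal.span {u ^ k})).symm.trans e2
  rw [e3.length_eq, Module.length_eq_finrank]
  simp

/-- The colength of `J + (g)` is the order of vanishing of `g` along a branch. -/
theorem le_length_quotient_iff (J : Ideal O) (u g : O) (ψ : O →ₐ[ℂ] PowerSeries ℂ) (N : ℕ)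
    (hunit : ∀ a : O, PowerSeries.constantCoeff (ψ a) ≠ 0 → IsUnit a)
    (hJ : ∀ a ∈ J, PowerSeries.X ^ N ∣ ψ a)
    (hu : ∀ a : O, ∃ c : ℂ, a - algebraMap ℂ O c ∈ J ⊔ Ideal.span {u})
    (w : PowerSeries ℂ) (hw : ψ u = PowerSeries.X * w) (hw0 : PowerSeries.constantCoeff w ≠ 0)
    (k : ℕ) (hk : k ≤ N) :
    (k : ℕ∞) ≤ Module.length ℂ (O ⧸ (J ⊔ Ideal.span {g})) ↔ PowerSeries.X ^ k ∣ ψ g := by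
  have hmem := mem_sup_span_pow_iff J u ψ N hJ hu w hw hw0
  have hlen := length_quotient_sup_span_pow J u ψ N hJ hu w hw hw0
  constructor
  · intro h
    by_contra hcon
    classical
    have hex : ∃ n, ¬ PowerSeries.X ^ n ∣ ψ g := ⟨k, hcon⟩
    obtain ⟨n, hn⟩ : ∃ n, Nat.find hex = n + 1 := by
      refine Nat.exists_eq_succ_of_ne_zero fun h0 => ?_
      have := Nat.find_spec hex
      rw [h0] at this
      simp at this
    have hnk : n + 1 ≤ k := hn ▸ Nat.find_min' hex hcon
    have h1 : PowerSeries.X ^ n ∣ ψ g := by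
      by_contra h'
      have := Nat.find_min' hex h'
      omega
    have h2 : ¬ PowerSeries.X ^ (n + 1) ∣ ψ g := hn ▸ Nat.find_spec hex
    -- Here `n < k` is the exact order of `ψ g`. Then `g` equals `u ^ n` times a unit modulo `J`, so
    -- the colength is `n`, contrary to the assumption.
    obtain ⟨j, hj, b, hb, rfl⟩ := Submodule.mem_sup.1 ((hmem n (by omega) g).2 h1)
    obtain ⟨b, rfl⟩ := Ideal.mem_span_singleton.1 hb
    have hbu : IsUnit b := by
      apply hunit
      intro hb0
      apply h2
      rw [map_add, map_mul, map_pow, hw, mul_pow, pow_succ, mul_assoc]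
      refine dvd_add ((pow_dvd_pow _ (by omega : n + 1 ≤ N)).trans (hJ j hj)) ?_
      exact mul_dvd_mul_left _ ((PowerSeries.X_dvd_iff.2 hb0).mul_left _)
    have heq : J ⊔ Ideal.span {j + u ^ n * b} = J ⊔ Ideal.span {u ^ n} := by
      apply le_antisymm
      · refine sup_le le_sup_left ((Ideal.span_singleton_le_iff_mem _).2 ?_)
        exact Submodule.add_mem_sup hj (Ideal.mul_mem_right _ _ (Ideal.mem_span_singleton_self _))
      · refine sup_le le_sup_left ((Ideal.span_singleton_le_iff_mem _).2 ?_)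
        obtain ⟨b', hb'⟩ := hbu.exists_right_inv
        have h3 : -(b' * j) + b' * (j + u ^ n * b) ∈ J ⊔ Ideal.span {j + u ^ n * b} :=
          Submodule.add_mem_sup (J.neg_mem (J.mul_mem_left _ hj))
            (Ideal.mul_mem_left _ _ (Ideal.mem_span_singleton_self _))
        have h4 : -(b' * j) + b' * (j + u ^ n * b) = u ^ n := by
          linear_combination u ^ n * hb'
        rwa [h4] at h3
    rw [heq, hlen n (by omega)] at h
    have := Nat.cast_le.1 h
    omega
  · intro h
    have hle : J ⊔ Ideal.span {g} ≤ J ⊔ Ideal.span {u ^ k} :=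
      sup_le le_sup_left ((Ideal.span_singleton_le_iff_mem _).2 ((hmem k hk g).2 h))
    rw [← hlen k hk]
    exact Module.length_le_of_surjective
      ((Submodule.factor hle).restrictScalars ℂ) (Submodule.factor_surjective hle)

end LocalAlgebra

/-! ### From intersection multiplicities with the Fermat curve to branches -/

theorem aeval_mul_of_isHomogeneous {B : Type*} [CommRing B] [Algebra ℂ B] {n : ℕ}
    {f : MvPolynomial (Fin 3) ℂ} (hf : f.IsHomogeneous n) (e : B) (γ : Fin 3 → B) :
    aeval (fun j => e * γ j) f = e ^ n * aeval γ f := by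
  rw [aeval_def, aeval_def, eval₂_eq, eval₂_eq, Finset.mul_sum]
  refine Finset.sum_congr rfl fun m hm => ?_
  have : e ^ n = ∏ i ∈ m.support, e ^ m i := by
    rw [Finset.prod_pow_eq_pow_sum]
    congr 1
    exact (hf.degree_eq_sum_deg_support hm)
  rw [this]
  simp only [mul_pow, Finset.prod_mul_distrib]
  ring

theorem PlaneCurve.isHomogeneous_form {n : ℕ} (Γ : PlaneCurve n) : Γ.form.IsHomogeneous n :=
  (mem_homogeneousSubmodule _ _).1 (Projectivization.rep Γ : homogeneousSubmodule (Fin 3) ℂ n).2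

theorem PlaneCurve.form_ne_zero {n : ℕ} (Γ : PlaneCurve n) : Γ.form ≠ 0 := fun h =>
  Γ.rep_nonzero (Subtype.ext h)

theorem PlaneCurve.exists_form_mk {n : ℕ} (f : homogeneousSubmodule (Fin 3) ℂ n) (hf : f ≠ 0) :
    ∃ a : ℂ, a ≠ 0 ∧ PlaneCurve.form (Projectivization.mk ℂ f hf : PlaneCurve n) =
      C a * (f : MvPolynomial (Fin 3) ℂ) := by
  obtain ⟨a, ha⟩ := Projectivization.exists_smul_eq_mk_rep ℂ f hf
  refine ⟨a, a.ne_zero, ?_⟩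
  rw [PlaneCurve.form, ← ha, C_mul']
  rfl

theorem PlaneCurve.eq_of_form {n : ℕ} (Γ Δ : PlaneCurve n) (a : ℂ)
    (h : Γ.form = C a * Δ.form) : Γ = Δ := by
  rw [← Projectivization.mk_rep Γ, ← Projectivization.mk_rep Δ, Projectivization.mk_eq_mk_iff']
  refine ⟨a, Subtype.ext ?_⟩
  rw [C_mul'] at h
  exact h.symm

theorem exists_fermatCurve_form (d : ℕ) :
    ∃ a : ℂ, a ≠ 0 ∧ (fermatCurve d).form = C a * ∑ j, X j ^ d := by
  obtain ⟨a, ha, h⟩ := PlaneCurve.exists_form_mk (fermatForm d) (fermatForm_ne_zero d)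
  refine ⟨a, ha, ?_⟩
  rw [fermatCurve, h, Fin.sum_univ_three]
  rfl

theorem sub_C_eval_mem (v : Fin 3 → ℂ) (I : Ideal (MvPolynomial (Fin 3) ℂ))
    (h : ∀ j, X j - C (v j) ∈ I) (f : MvPolynomial (Fin 3) ℂ) : f - C (eval v f) ∈ I := by
  induction f using MvPolynomial.induction_on with
  | C a => simp
  | add p q hp hq =>
    have : p + q - C (eval v (p + q)) = (p - C (eval v p)) + (q - C (eval v q)) := by
      simp only [map_add]; ring
    rw [this]; exact I.add_mem hp hq
  | mul_X p j hp =>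
    have : p * X j - C (eval v (p * X j)) =
        X j * (p - C (eval v p)) + C (eval v p) * (X j - C (v j)) := by
      simp only [map_mul, eval_X]; ring
    rw [this]; exact I.add_mem (I.mul_mem_left _ hp) (I.mul_mem_left _ (h j))

theorem univ_eq_of_ne {i j k : Fin 3} (hij : i ≠ j) (hik : i ≠ k) (hjk : j ≠ k) :
    (Finset.univ : Finset (Fin 3)) = {i, j, k} := by
  revert i j k; decide

theorem sum_eq_of_ne {M : Type*} [AddCommMonoid M] {i j k : Fin 3} (hij : i ≠ j) (hik : i ≠ k)
    (hjk : j ≠ k) (f : Fin 3 → M) : ∑ l, f l = f i + f j + f k := by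
  rw [univ_eq_of_ne hij hik hjk, Finset.sum_insert (by simp [hij, hik]),
    Finset.sum_insert (by simp [hjk]), Finset.sum_singleton, add_assoc]

theorem forall_of_ne {P : Fin 3 → Prop} {i j k : Fin 3} (hij : i ≠ j) (hik : i ≠ k) (hjk : j ≠ k)
    (hi : P i) (hj : P j) (hk : P k) (l : Fin 3) : P l := by
  have := Finset.mem_univ l
  rw [univ_eq_of_ne hij hik hjk] at this
  simp only [Finset.mem_insert, Finset.mem_singleton] at this
  rcases this with rfl | rfl | rfl <;> assumption

theorem constantCoeff_aeval (v : Fin 3 → ℂ) (γ : Fin 3 → PowerSeries ℂ)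
    (h0 : ∀ j, PowerSeries.constantCoeff (γ j) = v j) (f : MvPolynomial (Fin 3) ℂ) :
    PowerSeries.constantCoeff (aeval γ f) = eval v f := by
  induction f using MvPolynomial.induction_on with
  | C a => simp
  | add p q hp hq => simp [hp, hq]
  | mul_X p j hp => simp [hp, h0]

/-- The extension of a formal branch through `v` to the local ring of affine space at `v`. -/
noncomputable def localBranch (v : Fin 3 → ℂ) (γ : Fin 3 → PowerSeries ℂ)
    (h0 : ∀ j, PowerSeries.constantCoeff (γ j) = v j) :
    AffineLocalRing v →ₐ[ℂ] PowerSeries ℂ :=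
  IsLocalization.liftAlgHom
    (M := (nonZeroDivisors ℂ).comap (eval v : MvPolynomial (Fin 3) ℂ →+* ℂ)) (f := aeval γ)
    fun y => by
      rw [PowerSeries.isUnit_iff_constantCoeff, constantCoeff_aeval v γ h0, isUnit_iff_ne_zero]
      exact nonZeroDivisors.ne_zero y.2

theorem localBranch_algebraMap (v : Fin 3 → ℂ) (γ : Fin 3 → PowerSeries ℂ)
    (h0 : ∀ j, PowerSeries.constantCoeff (γ j) = v j) (f : MvPolynomial (Fin 3) ℂ) :
    localBranch v γ h0 (algebraMap _ _ f) = aeval γ f := by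
  rw [localBranch, IsLocalization.liftAlgHom_apply, IsLocalization.lift_eq]
  rfl

theorem isUnit_algebraMap_of_eval_ne_zero (v : Fin 3 → ℂ) (f : MvPolynomial (Fin 3) ℂ)
    (hf : eval v f ≠ 0) : IsUnit (algebraMap _ (AffineLocalRing v) f) :=
  IsLocalization.map_units (M := (nonZeroDivisors ℂ).comap
    (eval v : MvPolynomial (Fin 3) ℂ →+* ℂ)) (AffineLocalRing v)
    ⟨f, mem_nonZeroDivisors_of_ne_zero hf⟩

theorem isUnit_of_constantCoeff_localBranch (v : Fin 3 → ℂ) (γ : Fin 3 → PowerSeries ℂ)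
    (h0 : ∀ j, PowerSeries.constantCoeff (γ j) = v j) (a : AffineLocalRing v)
    (ha : PowerSeries.constantCoeff (localBranch v γ h0 a) ≠ 0) : IsUnit a := by
  obtain ⟨⟨f, g⟩, h⟩ := IsLocalization.surj
    ((nonZeroDivisors ℂ).comap (eval v : MvPolynomial (Fin 3) ℂ →+* ℂ)) a
  have h1 := congrArg (localBranch v γ h0) h
  rw [map_mul, localBranch_algebraMap, localBranch_algebraMap] at h1
  have h2 := congrArg PowerSeries.constantCoeff h1
  rw [map_mul, constantCoeff_aeval v γ h0, constantCoeff_aeval v γ h0] at h2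
  have hg : eval v (g : MvPolynomial (Fin 3) ℂ) ≠ 0 := nonZeroDivisors.ne_zero g.2
  have hf : eval v f ≠ 0 := by rw [← h2]; exact mul_ne_zero ha hg
  exact isUnit_of_mul_isUnit_left (h ▸ isUnit_algebraMap_of_eval_ne_zero v f hf)

/-- The residue field of the local ring is `ℂ`: a fraction `f / g` is congruent to its value at `v`
modulo any ideal that contains all `X j - v j`. -/
theorem exists_sub_algebraMap_mem (v : Fin 3 → ℂ) (I : Ideal (AffineLocalRing v))
    (h : ∀ j, algebraMap _ (AffineLocalRing v) (X j - C (v j)) ∈ I) (a : AffineLocalRing v) :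
    ∃ c : ℂ, a - algebraMap ℂ _ c ∈ I := by
  obtain ⟨⟨f, g⟩, hfg⟩ := IsLocalization.surj
    ((nonZeroDivisors ℂ).comap (eval v : MvPolynomial (Fin 3) ℂ →+* ℂ)) a
  have hg : eval v (g : MvPolynomial (Fin 3) ℂ) ≠ 0 := nonZeroDivisors.ne_zero g.2
  obtain ⟨b, hb⟩ := (isUnit_algebraMap_of_eval_ne_zero v g hg).exists_right_inv
  have hmem : ∀ f, algebraMap _ (AffineLocalRing v) (f - C (eval v f)) ∈ I := fun f =>
    sub_C_eval_mem v (I.comap (algebraMap _ _)) h f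
  have hC : ∀ c : ℂ, algebraMap (MvPolynomial (Fin 3) ℂ) (AffineLocalRing v) (C c) =
      algebraMap ℂ _ c := fun c =>
    (IsScalarTower.algebraMap_apply ℂ (MvPolynomial (Fin 3) ℂ) (AffineLocalRing v) c).symm
  refine ⟨eval v f / eval v (g : MvPolynomial (Fin 3) ℂ), ?_⟩
  set c := eval v f / eval v (g : MvPolynomial (Fin 3) ℂ) with hc
  have h1 := hmem (f - C c * (g : MvPolynomial (Fin 3) ℂ))
  have h2 : eval v (f - C c * (g : MvPolynomial (Fin 3) ℂ)) = 0 := by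
    simp [hc, hg]
  rw [h2, map_zero, sub_zero, map_sub, map_mul, hC] at h1
  have h3 : a - algebraMap ℂ _ c = b * (algebraMap _ (AffineLocalRing v) f -
      algebraMap ℂ _ c * algebraMap _ (AffineLocalRing v) (g : MvPolynomial (Fin 3) ℂ)) := by
    simp only at hfg
    linear_combination (algebraMap ℂ _ c - a) * hb + b * hfg
  rw [h3]
  exact I.mul_mem_left _ h1

/-- The intersection multiplicity with the Fermat curve is the order of vanishing along a
parametrized branch, which has to lie on the Fermat curve only up to the order considered. -/
theorem le_intersectionMultiplicity_fermatCurve_iff {d n N : ℕ} (hd : d ≠ 0) (Δ : PlaneCurve n)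
    (s : P2) (hs : ∑ j, s.rep j ^ d = 0) (γ : Fin 3 → PowerSeries ℂ)
    (h0 : ∀ j, PowerSeries.constantCoeff (γ j) = s.rep j)
    (hF : PowerSeries.X ^ N ∣ ∑ j, γ j ^ d) (l l' : Fin 3) (hl : l ≠ chart s) (hl' : l' ≠ chart s)
    (hll : l ≠ l') (hv : s.rep l' ≠ 0)
    (hγ : s.rep (chart s) * PowerSeries.coeff 1 (γ l) -
      s.rep l * PowerSeries.coeff 1 (γ (chart s)) ≠ 0) (k : ℕ) (hk : k ≤ N) :
    (k : ℕ∞) ≤ intersectionMultiplicity (fermatCurve d) Δ s ↔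
      PowerSeries.X ^ k ∣ aeval γ Δ.form := by
  set v := s.rep with hvdef
  set i := chart s with hi
  have hvi : v i ≠ 0 := chart_spec s
  obtain ⟨a, ha, hform⟩ := exists_fermatCurve_form d
  have hγi : PowerSeries.constantCoeff (γ i) ≠ 0 := by rw [h0]; exact hvi
  -- The factor `e` moves the branch into the plane `x_i = v_i` of the chart. Being a unit, it
  -- changes no order of vanishing of a form.
  set e : PowerSeries ℂ := PowerSeries.C (v i) * (γ i)⁻¹ with he
  have hei : e * γ i = PowerSeries.C (v i) := by
    rw [he, mul_assoc, PowerSeries.inv_mul_cancel _ hγi, mul_one]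
  have he0 : PowerSeries.constantCoeff e = 1 := by
    rw [he, map_mul, PowerSeries.constantCoeff_C, PowerSeries.constantCoeff_inv, h0]
    exact mul_inv_cancel₀ hvi
  have heu : IsUnit e := by
    rw [PowerSeries.isUnit_iff_constantCoeff, he0]; exact isUnit_one
  have h0' : ∀ j, PowerSeries.constantCoeff (e * γ j) = v j := fun j => by
    rw [map_mul, he0, one_mul, h0]
  set ψ := localBranch v (fun j => e * γ j) h0' with hψ
  have hψΔ : ∀ {m : ℕ} (f : MvPolynomial (Fin 3) ℂ), f.IsHomogeneous m →
      ψ (algebraMap _ _ f) = e ^ m * aeval γ f := fun f hf => by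
    rw [hψ, localBranch_algebraMap, aeval_mul_of_isHomogeneous hf]
  set A := algebraMap (MvPolynomial (Fin 3) ℂ) (AffineLocalRing v) with hA
  set J : Ideal (AffineLocalRing v) :=
    Ideal.span {A (fermatCurve d).form, A (X i - C (v i))} with hJ
  have hideal : Ideal.map A (Ideal.span {(fermatCurve d).form, Δ.form, X i - C (v i)}) =
      J ⊔ Ideal.span {A Δ.form} := by
    rw [Ideal.map_span, hJ, ← Ideal.span_union]
    congr 1
    simp only [Set.image_insert_eq, Set.image_singleton]
    ext x
    simp only [Set.mem_insert_iff, Set.mem_singleton_iff, Set.union_singleton]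
    tauto
  have hxi : A (X i - C (v i)) ∈ J := Ideal.subset_span (by simp)
  have hfm : A (fermatCurve d).form ∈ J := Ideal.subset_span (by simp)
  have hJN : ∀ x ∈ J, PowerSeries.X ^ N ∣ ψ x := by
    have hle : J ≤ (Ideal.span {PowerSeries.X ^ N}).comap ψ := by
      rw [hJ, Ideal.span_le]
      rintro x (rfl | rfl)
      · rw [SetLike.mem_coe, Ideal.mem_comap, Ideal.mem_span_singleton,
          hψΔ _ (fermatCurve d).isHomogeneous_form, hform]
        refine Dvd.dvd.mul_left ?_ _
        rw [map_mul, map_sum]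
        simp only [map_pow, aeval_X]
        exact hF.mul_left _
      · rw [SetLike.mem_coe, Ideal.mem_comap, Ideal.mem_span_singleton, hψ, hA,
          localBranch_algebraMap]
        simp [hei]
    intro x hx
    exact Ideal.mem_span_singleton.1 (hle hx)
  set u := A (X l - C (v l)) with hu
  have hψu : ψ u = e * γ l - PowerSeries.C (v l) := by
    rw [hu, hA, hψ, localBranch_algebraMap]
    simp
  have hXu : PowerSeries.X ∣ ψ u := by
    rw [hψu, PowerSeries.X_dvd_iff, map_sub, h0', PowerSeries.constantCoeff_C, sub_self]
  obtain ⟨w, hw⟩ := hXu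
  have c1 : ∀ f g : PowerSeries ℂ, PowerSeries.coeff 1 (f * g) =
      PowerSeries.constantCoeff f * PowerSeries.coeff 1 g +
      PowerSeries.coeff 1 f * PowerSeries.constantCoeff g := by
    intro f g
    rw [PowerSeries.coeff_mul, Finset.Nat.antidiagonal_succ]
    simp
  have hC1 : ∀ c : ℂ, PowerSeries.coeff 1 (PowerSeries.C c) = 0 := fun c => by
    rw [PowerSeries.coeff_C]; simp
  -- The hypothesis `hγ` says that `x_l / x_i` has nonzero derivative along the branch, so `u` pulls
  -- back to a series of order exactly one.
  have hw0 : PowerSeries.constantCoeff w ≠ 0 := by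
    have e1 := congrArg (PowerSeries.coeff 1) hei
    rw [c1, he0, h0, hC1] at e1
    have e2 := congrArg (PowerSeries.coeff 1) hw
    rw [hψu, map_sub, c1 e, he0, h0, hC1, c1 PowerSeries.X w] at e2
    rw [PowerSeries.constantCoeff_X, PowerSeries.coeff_one_X] at e2
    intro hw0
    apply hγ
    rw [hw0] at e2
    linear_combination v i * e2 - v l * e1
  have hsum : ∀ f : Fin 3 → AffineLocalRing v, ∑ j, f j = f i + f l' + f l :=
    sum_eq_of_ne hl'.symm hl.symm hll.symm
  have hpow : ∀ j, A (X j ^ d - C (v j ^ d)) = A (X j - C (v j)) *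
      A (∑ m ∈ Finset.range d, X j ^ m * C (v j) ^ (d - 1 - m)) := fun j => by
    rw [← map_mul, mul_comm, (Commute.all _ _).geom_sum₂_mul, C_pow]
  -- The remaining coordinate is controlled by the curve: `X l' ^ d - v l' ^ d` lies in `J + (u)`,
  -- and its cofactor over `X l' - v l'` has the value `d * v l' ^ (d - 1) ≠ 0` at `v`, hence is a
  -- unit. Thus `u` generates the maximal ideal modulo `J`.
  have hl'mem : A (X l' - C (v l')) ∈ J ⊔ Ideal.span {u} := by
    have hgu : IsUnit (A (∑ m ∈ Finset.range d, X l' ^ m * C (v l') ^ (d - 1 - m))) := by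
      apply isUnit_algebraMap_of_eval_ne_zero
      simp only [map_sum, map_mul, map_pow, eval_X, eval_C]
      rw [geom_sum₂_self]
      exact mul_ne_zero (Nat.cast_ne_zero.2 hd) (pow_ne_zero _ hv)
    refine (Ideal.mul_unit_mem_iff_mem _ hgu).1 ?_
    rw [← hpow]
    have hF' : A (∑ j, X j ^ d) ∈ J := by
      have : A (∑ j, X j ^ d) = A (C a⁻¹) * A (fermatCurve d).form := by
        rw [← map_mul, hform, ← mul_assoc, ← C_mul, inv_mul_cancel₀ ha, C_1, one_mul]
      rw [this]
      exact J.mul_mem_left _ hfm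
    have h1 : A (X l' ^ d - C (v l' ^ d)) = A (∑ j, X j ^ d) - A (X i ^ d - C (v i ^ d)) -
        A (X l ^ d - C (v l ^ d)) := by
      have h2 : A (C (∑ j, v j ^ d)) = 0 := by rw [hs]; simp
      rw [map_sum, map_sum, hsum] at h2
      rw [map_sum, hsum]
      simp only [map_sub]
      linear_combination -h2
    rw [h1, hpow i, hpow l]
    refine sub_mem (sub_mem (Ideal.mem_sup_left hF') (Ideal.mem_sup_left ?_))
      (Ideal.mem_sup_right ?_)
    · exact J.mul_mem_right _ hxi
    · exact Ideal.mul_mem_right _ _ (Ideal.mem_span_singleton_self _)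
  have hlocal : ∀ x : AffineLocalRing v, ∃ c : ℂ, x - algebraMap ℂ _ c ∈ J ⊔ Ideal.span {u} :=
    exists_sub_algebraMap_mem v _ (forall_of_ne hl'.symm hl.symm hll.symm
      (Ideal.mem_sup_left hxi) hl'mem (Ideal.mem_sup_right (Ideal.mem_span_singleton_self _)))
  have := le_length_quotient_iff J u (A Δ.form) ψ N
    (isUnit_of_constantCoeff_localBranch v _ h0') hJN hlocal w hw hw0 k hk
  rw [← hideal, hψΔ _ Δ.isHomogeneous_form] at this
  refine Iff.trans this ?_
  exact (heu.pow n).dvd_mul_left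

/-! ### Multiplicity of a curve at a point -/

/-- Substitution of the Taylor expansion in the affine chart around `p`. -/
noncomputable def taylorAt (p : P2) : MvPolynomial (Fin 3) ℂ →ₐ[ℂ] MvPolynomial (Fin 3) ℂ :=
  aeval fun j : Fin 3 => if j = chart p then C (p.rep j) else X j + C (p.rep j)

theorem multiplicityAt_eq {n : ℕ} (Γ : PlaneCurve n) (p : P2) : multiplicityAt Γ p =
    MvPowerSeries.order (taylorAt p Γ.form : MvPowerSeries (Fin 3) ℂ) := rfl

theorem coeff_zero_taylorAt (p : P2) (f : MvPolynomial (Fin 3) ℂ) :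
    coeff 0 (taylorAt p f) = eval p.rep f := by
  rw [← constantCoeff_eq]
  induction f using MvPolynomial.induction_on with
  | C a => rw [taylorAt, aeval_C]; simp
  | add p q hp hq => rw [map_add, map_add, hp, hq, map_add]
  | mul_X q j hq =>
    rw [map_mul, map_mul, hq, map_mul, taylorAt, aeval_X, eval_X]
    split_ifs <;> simp

theorem coeff_single_taylorAt (p : P2) (j : Fin 3) (hj : j ≠ chart p)
    (f : MvPolynomial (Fin 3) ℂ) :
    coeff (Finsupp.single j 1) (taylorAt p f) = eval p.rep (pderiv j f) := by
  classical
  have hmul : ∀ f g : MvPolynomial (Fin 3) ℂ, coeff (Finsupp.single j 1) (f * g) =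
      coeff 0 f * coeff (Finsupp.single j 1) g + coeff (Finsupp.single j 1) f * coeff 0 g := by
    intro f g
    rw [coeff_mul, Finsupp.antidiagonal_single, Finset.sum_map, Finset.Nat.antidiagonal_succ]
    simp
  have hs0 : (0 : Fin 3 →₀ ℕ) ≠ Finsupp.single j 1 := by simp [eq_comm]
  induction f using MvPolynomial.induction_on with
  | C a => rw [taylorAt, aeval_C]; simp [coeff_C, hs0]
  | add p q hp hq => rw [map_add, coeff_add, hp, hq, map_add, map_add]
  | mul_X q i hq =>
    rw [map_mul, hmul, hq, coeff_zero_taylorAt, coeff_zero_taylorAt, Derivation.leibniz,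
      pderiv_X, taylorAt, aeval_X, eval_X]
    by_cases hij : i = j
    · subst hij
      simp [hj, hs0]
      ring
    · split_ifs <;> simp [hij, coeff_X, hs0, Finsupp.single_left_inj] <;> ring

theorem eval_rep_eq_zero_of_isSmoothPoint {n : ℕ} (Γ : PlaneCurve n) (s : P2)
    (h : IsSmoothPoint Γ s) : eval s.rep Γ.form = 0 := by
  rw [← coeff_zero_taylorAt, ← MvPolynomial.coeff_coe, MvPowerSeries.coeff_zero_eq_constantCoeff,
    ← MvPowerSeries.one_le_order_iff_constCoeff_eq_zero]
  exact h.ge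

theorem multiplicityAt_eq_one {n : ℕ} (Γ : PlaneCurve n) (p : P2) (h : eval p.rep Γ.form = 0)
    (j : Fin 3) (hj : j ≠ chart p) (h' : eval p.rep (pderiv j Γ.form) ≠ 0) :
    multiplicityAt Γ p = 1 := by
  rw [multiplicityAt_eq]
  apply le_antisymm
  · have := MvPowerSeries.order_le (f := (taylorAt p Γ.form : MvPowerSeries (Fin 3) ℂ))
      (d := Finsupp.single j 1) (by rwa [MvPolynomial.coeff_coe, coeff_single_taylorAt p j hj])
    simpa using this
  · rw [MvPowerSeries.one_le_order_iff_constCoeff_eq_zero,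
      ← MvPowerSeries.coeff_zero_eq_constantCoeff, MvPolynomial.coeff_coe, coeff_zero_taylorAt, h]

/-! ### Binomial series and the linear algebra of conics with contact of order six -/

theorem succ_mul_choose_succ (m : ℂ) (n : ℕ) :
    ((n : ℂ) + 1) * Ring.choose m (n + 1) = Ring.choose m n * (m - n) := by
  have := Ring.choose_smul_choose m (n := n + 1) (k := n) (Nat.le_succ n)
  rw [Nat.choose_succ_self_right, nsmul_eq_mul, Nat.add_sub_cancel_left, Ring.choose_one_right]
    at this
  exact_mod_cast this

/-- The power series `(1 + a t) ^ m`. -/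
noncomputable def powSeries (m a : ℂ) : PowerSeries ℂ :=
  PowerSeries.rescale a (PowerSeries.binomialSeries ℂ m)

theorem coeff_powSeries (m a : ℂ) (n : ℕ) :
    PowerSeries.coeff n (powSeries m a) = a ^ n * Ring.choose m n := by
  rw [powSeries, PowerSeries.coeff_rescale, PowerSeries.binomialSeries_coeff, smul_eq_mul, mul_one]

/-- Binomial series multiply by adding exponents. This makes the `d`-th powers of the branch
coordinates linear in `t`, so that the branch lies on the curve to all orders. -/
theorem powSeries_inv_pow (d : ℕ) (hd : d ≠ 0) (a : ℂ) :
    powSeries (d : ℂ)⁻¹ a ^ d = 1 + PowerSeries.C a * PowerSeries.X := by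
  have h : ∀ n : ℕ, PowerSeries.binomialSeries ℂ (d : ℂ)⁻¹ ^ n =
      PowerSeries.binomialSeries ℂ (n * (d : ℂ)⁻¹) := by
    intro n
    induction n with
    | zero => simp
    | succ n ih =>
      rw [pow_succ, ih, ← PowerSeries.binomialSeries_add]
      congr 1
      push_cast
      ring
  rw [powSeries, ← map_pow, h, mul_inv_cancel₀ (Nat.cast_ne_zero.2 hd)]
  have := PowerSeries.binomialSeries_nat (R := ℂ) (A := ℂ) 1
  rw [Nat.cast_one, pow_one] at this
  rw [this, map_add, map_one, PowerSeries.rescale_X]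

/-- The coefficient of `t ^ n` in `(1 + a t) ^ m * (1 + b t) ^ m`. -/
noncomputable def prodCoeff (m a b : ℂ) (n : ℕ) : ℂ :=
  PowerSeries.coeff n (powSeries m a * powSeries m b)

theorem prodCoeff_eq (m a b : ℂ) :
    prodCoeff m a b 0 = 1 ∧
    prodCoeff m a b 1 = m * (a + b) ∧
    prodCoeff m a b 2 = m * (m - 1) / 2 * (a ^ 2 + b ^ 2) + m ^ 2 * a * b ∧
    prodCoeff m a b 3 = m * (m - 1) * (m - 2) / 6 * (a ^ 3 + b ^ 3) +
      m * (m * (m - 1) / 2) * (a ^ 2 * b + a * b ^ 2) ∧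
    prodCoeff m a b 4 = m * (m - 1) * (m - 2) * (m - 3) / 24 * (a ^ 4 + b ^ 4) +
      m * (m * (m - 1) * (m - 2) / 6) * (a ^ 3 * b + a * b ^ 3) +
      (m * (m - 1) / 2) ^ 2 * (a ^ 2 * b ^ 2) ∧
    prodCoeff m a b 5 = m * (m - 1) * (m - 2) * (m - 3) * (m - 4) / 120 * (a ^ 5 + b ^ 5) +
      m * (m * (m - 1) * (m - 2) * (m - 3) / 24) * (a ^ 4 * b + a * b ^ 4) +
      (m * (m - 1) / 2) * (m * (m - 1) * (m - 2) / 6) * (a ^ 3 * b ^ 2 + a ^ 2 * b ^ 3) := by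
  have c0 : Ring.choose m 0 = 1 := Ring.choose_zero_right m
  have c1 : Ring.choose m 1 = m := Ring.choose_one_right m
  have c2 : Ring.choose m 2 = m * (m - 1) / 2 := by
    have := succ_mul_choose_succ m 1
    rw [c1] at this
    norm_num at this
    linear_combination this / 2
  have c3 : Ring.choose m 3 = m * (m - 1) * (m - 2) / 6 := by
    have := succ_mul_choose_succ m 2
    rw [c2] at this
    norm_num at this
    linear_combination this / 3
  have c4 : Ring.choose m 4 = m * (m - 1) * (m - 2) * (m - 3) / 24 := by
    have := succ_mul_choose_succ m 3
    rw [c3] at this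
    norm_num at this
    linear_combination this / 4
  have c5 : Ring.choose m 5 = m * (m - 1) * (m - 2) * (m - 3) * (m - 4) / 120 := by
    have := succ_mul_choose_succ m 4
    rw [c4] at this
    norm_num at this
    linear_combination this / 5
  refine ⟨?_, ?_, ?_, ?_, ?_, ?_⟩ <;>
  · simp only [prodCoeff, PowerSeries.coeff_mul, Finset.Nat.antidiagonal_succ,
      Finset.Nat.antidiagonal_zero, Finset.map_singleton, Finset.sum_cons, Finset.map_cons,
      Finset.sum_singleton, Function.Embedding.prodMap, Function.Embedding.coeFn_mk,
      Prod.map, Function.Embedding.refl_apply, coeff_powSeries, Nat.succ_eq_add_one,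
      zero_add, Nat.reduceAdd, c0, c1, c2, c3, c4, c5]
    ring

/-- The equations for a conic `A x² + B y² + C z² + D yz + E xz + H xy` to have contact of order six
with the branch `((1 + αt)ᵐ, (1 + βt)ᵐ, (1 + γt)ᵐ)` where `α + β + γ = 0`, in terms of the moments
of its coefficients. -/
theorem conic_moments (m α β γ A B C D E H : ℂ) (hsum : α + β + γ = 0)
    (h : ∀ n < 6, A * prodCoeff m α α n + B * prodCoeff m β β n + C * prodCoeff m γ γ n +
      D * prodCoeff m β γ n + E * prodCoeff m α γ n + H * prodCoeff m α β n = 0)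
    (A0 A1 A2 D0 D1 D2 s p : ℂ) (hA0 : A0 = A + B + C) (hA1 : A1 = A * α + B * β + C * γ)
    (hA2 : A2 = A * α ^ 2 + B * β ^ 2 + C * γ ^ 2) (hD0 : D0 = D + E + H)
    (hD1 : D1 = D * α + E * β + H * γ) (hD2 : D2 = D * α ^ 2 + E * β ^ 2 + H * γ ^ 2)
    (hs : s = α * β + β * γ + γ * α) (hp : p = α * β * γ) :
    A0 + D0 = 0 ∧ m * (2 * A1 - D1) = 0 ∧
    m * ((2 * m - 1) * A2 + s * D0 + (m + 1) / 2 * D2) = 0 ∧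
    m * (m - 1) * (2 * (2 * m - 1) / 3 * (p * A0 - s * A1) - p * D0 -
      (m - 2) / 6 * (p * D0 - s * D1)) = 0 ∧
    m * (m - 1) * ((2 * m - 1) * (2 * m - 3) / 6 * (p * A1 - s * A2) +
      (s ^ 2 * D0 + s * D2 + p * D1) / 2 + (m - 2) / 2 * p * D1 +
      (m - 2) * (m - 3) / 24 * (p * D1 - s * D2)) = 0 ∧
    m * (m - 1) * (m - 2) * ((2 * m - 1) * (2 * m - 3) / 15 * (p * A2 - s * p * A0 + s ^ 2 * A1) -
      (s * p * D0 + p * D2) / 2 - (m - 3) / 6 * p * D2 -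
      (m - 3) * (m - 4) / 120 * (p * D2 - s * p * D0 + s ^ 2 * D1)) = 0 := by
  have hγ : γ = -α - β := by linear_combination hsum
  obtain ⟨x0, x1, x2, x3, x4, x5⟩ := prodCoeff_eq m α α
  obtain ⟨y0, y1, y2, y3, y4, y5⟩ := prodCoeff_eq m β β
  obtain ⟨z0, z1, z2, z3, z4, z5⟩ := prodCoeff_eq m γ γ
  obtain ⟨u0, u1, u2, u3, u4, u5⟩ := prodCoeff_eq m β γ
  obtain ⟨v0, v1, v2, v3, v4, v5⟩ := prodCoeff_eq m α γ
  obtain ⟨w0, w1, w2, w3, w4, w5⟩ := prodCoeff_eq m α β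
  have h0 := h 0 (by norm_num)
  have h1 := h 1 (by norm_num)
  have h2 := h 2 (by norm_num)
  have h3 := h 3 (by norm_num)
  have h4 := h 4 (by norm_num)
  have h5 := h 5 (by norm_num)
  rw [x0, y0, z0, u0, v0, w0] at h0
  rw [x1, y1, z1, u1, v1, w1] at h1
  rw [x2, y2, z2, u2, v2, w2] at h2
  rw [x3, y3, z3, u3, v3, w3] at h3
  rw [x4, y4, z4, u4, v4, w4] at h4
  rw [x5, y5, z5, u5, v5, w5] at h5
  -- Since `α`, `β`, `γ` are the roots of `x³ + s x - p`, higher moments reduce to the first three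
  -- by `α³ = p - s α`. The mixed terms depend on a single root through `β + γ = -α` and `β γ = s +
  -- α²`, which is why `D` is paired with `α`, `E` with `β` and `H` with `γ`.
  subst hA0 hA1 hA2 hD0 hD1 hD2 hs hp hγ
  refine ⟨?_, ?_, ?_, ?_, ?_, ?_⟩
  · linear_combination h0
  · linear_combination h1
  · linear_combination h2
  · linear_combination h3
  · linear_combination h4
  · linear_combination h5

/-- The equations of orders `0, 1, 2` express the moments of the mixed coefficients through those of
the squares. Substituted in orders `3, 4, 5`, they leave three equations in `A0`, `A1`, `A2` alone.
-/
theorem moments_reduce (m A0 A1 A2 D0 D1 D2 s p : ℂ) (hm0 : m ≠ 0) (hm1 : m ≠ 1) (hm2 : m ≠ 2)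
    (h : A0 + D0 = 0 ∧ m * (2 * A1 - D1) = 0 ∧
    m * ((2 * m - 1) * A2 + s * D0 + (m + 1) / 2 * D2) = 0 ∧
    m * (m - 1) * (2 * (2 * m - 1) / 3 * (p * A0 - s * A1) - p * D0 -
      (m - 2) / 6 * (p * D0 - s * D1)) = 0 ∧
    m * (m - 1) * ((2 * m - 1) * (2 * m - 3) / 6 * (p * A1 - s * A2) +
      (s ^ 2 * D0 + s * D2 + p * D1) / 2 + (m - 2) / 2 * p * D1 +
      (m - 2) * (m - 3) / 24 * (p * D1 - s * D2)) = 0 ∧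
    m * (m - 1) * (m - 2) * ((2 * m - 1) * (2 * m - 3) / 15 * (p * A2 - s * p * A0 + s ^ 2 * A1) -
      (s * p * D0 + p * D2) / 2 - (m - 3) / 6 * p * D2 -
      (m - 3) * (m - 4) / 120 * (p * D2 - s * p * D0 + s ^ 2 * D1)) = 0) :
    D0 = -A0 ∧ D1 = 2 * A1 ∧ (m + 1) * D2 = 2 * (s * A0 - (2 * m - 1) * A2) ∧
    3 * p * A0 = 2 * s * A1 ∧ 9 * (m - 1) * p * A1 - 3 * (2 * m - 1) * s * A2 - s ^ 2 * A0 = 0 ∧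
    10 * (3 * m - 5) * s ^ 2 * A1 + 3 * (23 - 11 * m) * s * p * A0 +
      18 * (2 * m - 1) * p * A2 = 0 := by
  obtain ⟨h0, h1, h2, h3, h4, h5⟩ := h
  have hm1' := sub_ne_zero.2 hm1
  have hm2' := sub_ne_zero.2 hm2
  have r0 : D0 = -A0 := by linear_combination h0
  have r1 : D1 = 2 * A1 := by
    linear_combination -(mul_eq_zero.1 h1).resolve_left hm0
  have r2 : (m + 1) * D2 = 2 * (s * A0 - (2 * m - 1) * A2) := by
    linear_combination 2 * (mul_eq_zero.1 h2).resolve_left hm0 - 2 * s * r0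
  have h3 := (mul_eq_zero.1 h3).resolve_left (mul_ne_zero hm0 hm1')
  have h4 := (mul_eq_zero.1 h4).resolve_left (mul_ne_zero hm0 hm1')
  have h5 := (mul_eq_zero.1 h5).resolve_left (mul_ne_zero (mul_ne_zero hm0 hm1') hm2')
  subst r0 r1
  refine ⟨rfl, rfl, r2, ?_, ?_, ?_⟩
  · refine mul_left_cancel₀ hm0 ?_
    linear_combination 2 * h3
  · refine (mul_eq_zero.1 (?_ : m * _ = 0)).resolve_left hm0
    -- The coefficient of `D2` in `12 * h4` is `s * (6 - m) * (m + 1) / 2`, and in `120 * h5` below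
    -- it is `-p * (m + 12) * (m + 1)`, so `r2` eliminates `D2` without division by `m + 1`.
    linear_combination 12 * h4 - (6 - m) / 2 * s * r2
  · refine (mul_eq_zero.1 (?_ : m * _ = 0)).resolve_left hm0
    linear_combination 120 * h5 + (m + 12) * p * r2

/-- Eliminating `A1` from the first and third equations gives `3 A2 = -s A0`. The second then gives
`9 p A1 = -2 s² A0`, and the first becomes a multiple of the discriminant of `x³ + s x - p` times
`A0`. -/
theorem moments_eq_zero (m A0 A1 A2 s p : ℂ) (hm1 : m ≠ 1) (hm : 2 * m - 1 ≠ 0) (hp : p ≠ 0)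
    (hdisc : 27 * p ^ 2 + 4 * s ^ 3 ≠ 0) (h3 : 3 * p * A0 = 2 * s * A1)
    (h4 : 9 * (m - 1) * p * A1 - 3 * (2 * m - 1) * s * A2 - s ^ 2 * A0 = 0)
    (h5 : 10 * (3 * m - 5) * s ^ 2 * A1 + 3 * (23 - 11 * m) * s * p * A0 +
      18 * (2 * m - 1) * p * A2 = 0) : A0 = 0 ∧ A1 = 0 ∧ A2 = 0 := by
  have hm1' := sub_ne_zero.2 hm1
  have e1 : 3 * A2 = -s * A0 := by
    refine mul_left_cancel₀ (mul_ne_zero hm hp) ?_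
    linear_combination (1 / 6) * h5 + 5 / 6 * (3 * m - 5) * s * h3
  have e2 : 9 * p * A1 + 2 * s ^ 2 * A0 = 0 := by
    refine (mul_eq_zero.1 (?_ : (m - 1) * _ = 0)).resolve_left hm1'
    linear_combination h4 + (2 * m - 1) * s * e1
  have hA0 : A0 = 0 := by
    refine (mul_eq_zero.1 (?_ : (27 * p ^ 2 + 4 * s ^ 3) * A0 = 0)).resolve_left hdisc
    linear_combination 9 * p * h3 + 2 * s * e2
  subst hA0
  refine ⟨rfl, ?_, ?_⟩
  · refine (mul_eq_zero.1 (?_ : p * A1 = 0)).resolve_left hp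
    linear_combination e2 / 9
  · linear_combination e1 / 3

/-! ### Coefficients of linear and quadratic forms in a chosen order of the variables -/

theorem exists_linear_coeffs {i j k : Fin 3} (hij : i ≠ j) (hik : i ≠ k) (hjk : j ≠ k)
    {f : MvPolynomial (Fin 3) ℂ} (hf : f.IsHomogeneous 1) :
    ∃ a b c : ℂ, f = C a * X i + C b * X j + C c * X k := by
  rw [f.as_sum]
  refine Finset.sum_induction _
    (fun g => ∃ a b c : ℂ, g = C a * X i + C b * X j + C c * X k) ?_ ⟨0, 0, 0, by simp⟩ ?_
  · rintro _ _ ⟨a, b, c, rfl⟩ ⟨a', b', c', rfl⟩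
    exact ⟨a + a', b + b', c + c', by simp only [C_add]; ring⟩
  · intro m hm
    have hdeg := hf (mem_support_iff.1 hm)
    rw [Finsupp.weight_apply, Finsupp.sum_fintype _ _ (by simp), sum_eq_of_ne hij hik hjk] at hdeg
    simp only [Pi.one_apply, smul_eq_mul, mul_one] at hdeg
    rw [monomial_eq, Finsupp.prod_fintype _ _ (by simp)]
    have hprod : ∏ l, (X l : MvPolynomial (Fin 3) ℂ) ^ m l =
        X i ^ m i * (X j ^ m j * X k ^ m k) := by
      rw [univ_eq_of_ne hij hik hjk, Finset.prod_insert (by simp [hij, hik]),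
        Finset.prod_insert (by simp [hjk]), Finset.prod_singleton]
    rw [hprod]
    set c := coeff m f
    rcases (by omega : (m i = 1 ∧ m j = 0 ∧ m k = 0) ∨ (m i = 0 ∧ m j = 1 ∧ m k = 0) ∨
      (m i = 0 ∧ m j = 0 ∧ m k = 1)) with ⟨h1, h2, h3⟩ | ⟨h1, h2, h3⟩ | ⟨h1, h2, h3⟩
    · exact ⟨c, 0, 0, by simp [h1, h2, h3]⟩
    · exact ⟨0, c, 0, by simp [h1, h2, h3]⟩
    · exact ⟨0, 0, c, by simp [h1, h2, h3]⟩

theorem exists_conic_coeffs {i j k : Fin 3} (hij : i ≠ j) (hik : i ≠ k) (hjk : j ≠ k)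
    {f : MvPolynomial (Fin 3) ℂ} (hf : f.IsHomogeneous 2) :
    ∃ a b c u v w : ℂ, f = C a * X i ^ 2 + C b * X j ^ 2 + C c * X k ^ 2 +
      C u * (X j * X k) + C v * (X i * X k) + C w * (X i * X j) := by
  rw [f.as_sum]
  refine Finset.sum_induction _
    (fun g => ∃ a b c u v w : ℂ, g = C a * X i ^ 2 + C b * X j ^ 2 + C c * X k ^ 2 +
      C u * (X j * X k) + C v * (X i * X k) + C w * (X i * X j)) ?_ ⟨0, 0, 0, 0, 0, 0, by simp⟩ ?_
  · rintro _ _ ⟨a, b, c, u, v, w, rfl⟩ ⟨a', b', c', u', v', w', rfl⟩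
    exact ⟨a + a', b + b', c + c', u + u', v + v', w + w', by simp only [C_add]; ring⟩
  · intro m hm
    have hdeg := hf (mem_support_iff.1 hm)
    rw [Finsupp.weight_apply, Finsupp.sum_fintype _ _ (by simp), sum_eq_of_ne hij hik hjk] at hdeg
    simp only [Pi.one_apply, smul_eq_mul, mul_one] at hdeg
    rw [monomial_eq, Finsupp.prod_fintype _ _ (by simp)]
    have hprod : ∏ l, (X l : MvPolynomial (Fin 3) ℂ) ^ m l =
        X i ^ m i * (X j ^ m j * X k ^ m k) := by
      rw [univ_eq_of_ne hij hik hjk, Finset.prod_insert (by simp [hij, hik]),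
        Finset.prod_insert (by simp [hjk]), Finset.prod_singleton]
    rw [hprod]
    set c := coeff m f
    rcases (by omega : (m i = 2 ∧ m j = 0 ∧ m k = 0) ∨ (m i = 0 ∧ m j = 2 ∧ m k = 0) ∨
      (m i = 0 ∧ m j = 0 ∧ m k = 2) ∨ (m i = 0 ∧ m j = 1 ∧ m k = 1) ∨
      (m i = 1 ∧ m j = 0 ∧ m k = 1) ∨ (m i = 1 ∧ m j = 1 ∧ m k = 0)) with
      ⟨h1, h2, h3⟩ | ⟨h1, h2, h3⟩ | ⟨h1, h2, h3⟩ | ⟨h1, h2, h3⟩ | ⟨h1, h2, h3⟩ | ⟨h1, h2, h3⟩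
    · exact ⟨c, 0, 0, 0, 0, 0, by simp [h1, h2, h3]⟩
    · exact ⟨0, c, 0, 0, 0, 0, by simp [h1, h2, h3]⟩
    · exact ⟨0, 0, c, 0, 0, 0, by simp [h1, h2, h3]⟩
    · exact ⟨0, 0, 0, c, 0, 0, by simp [h1, h2, h3]⟩
    · exact ⟨0, 0, 0, 0, c, 0, by simp [h1, h2, h3]⟩
    · exact ⟨0, 0, 0, 0, 0, c, by simp [h1, h2, h3]⟩

/-! ### Tangent lines, sextactic points and hyperosculating conics of the Fermat curve -/

/-- A parametrization `v_j (1 + ρ_j t) ^ (1 / d)` of the branch of the Fermat curve at `v`. -/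
noncomputable def fermatBranch (d : ℕ) (v ρ : Fin 3 → ℂ) (j : Fin 3) : PowerSeries ℂ :=
  PowerSeries.C (v j) * powSeries (d : ℂ)⁻¹ (ρ j)

/-- The sum of `d`-th powers along the branch is `∑ v_j ^ d + t * ∑ v_j ^ d * ρ_j = 0`, so no bound
on `k` is needed. Distinct weights make the branch regular: the derivative in the chart is a nonzero
multiple of `ρ_l - ρ_i`. -/
theorem le_intersectionMultiplicity_iff_fermatBranch {d n : ℕ} (hd : d ≠ 0) (Δ : PlaneCurve n)
    (s : P2) (hs : ∑ j, s.rep j ^ d = 0) (hv : ∀ j, s.rep j ≠ 0) (ρ : Fin 3 → ℂ)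
    (hρ : ∑ j, s.rep j ^ d * ρ j = 0) (hinj : Function.Injective ρ) (k : ℕ) :
    (k : ℕ∞) ≤ intersectionMultiplicity (fermatCurve d) Δ s ↔
      PowerSeries.X ^ k ∣ aeval (fermatBranch d s.rep ρ) Δ.form := by
  obtain ⟨l, l', hl, hl', hll⟩ : ∃ l l' : Fin 3, l ≠ chart s ∧ l' ≠ chart s ∧ l ≠ l' := by
    generalize chart s = i
    revert i; decide
  have hd' : (d : ℂ)⁻¹ ≠ 0 := inv_ne_zero (Nat.cast_ne_zero.2 hd)
  refine le_intersectionMultiplicity_fermatCurve_iff hd Δ s hs _ ?_ (N := k) ?_ l l' hl hl' hll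
    (hv l') ?_ k le_rfl
  · intro j
    rw [fermatBranch, map_mul, PowerSeries.constantCoeff_C,
      ← PowerSeries.coeff_zero_eq_constantCoeff_apply, coeff_powSeries]
    simp
  · have : ∑ j, fermatBranch d s.rep ρ j ^ d = 0 := by
      have h1 : ∀ j, fermatBranch d s.rep ρ j ^ d = PowerSeries.C (s.rep j ^ d) +
          PowerSeries.C (s.rep j ^ d * ρ j) * PowerSeries.X := by
        intro j
        rw [fermatBranch, mul_pow, powSeries_inv_pow d hd, map_mul, map_pow]
        ring
      rw [Finset.sum_congr rfl fun j _ => h1 j, Finset.sum_add_distrib, ← Finset.sum_mul,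
        ← map_sum, ← map_sum, hs, hρ]
      simp
    rw [this]
    exact dvd_zero _
  · have h1 : ∀ j, PowerSeries.coeff 1 (fermatBranch d s.rep ρ j) =
        s.rep j * (ρ j * (d : ℂ)⁻¹) := by
      intro j
      rw [fermatBranch, PowerSeries.coeff_C_mul, coeff_powSeries, Ring.choose_one_right, pow_one]
    rw [h1, h1]
    have h2 : s.rep (chart s) * (s.rep l * (ρ l * (d : ℂ)⁻¹)) -
        s.rep l * (s.rep (chart s) * (ρ (chart s) * (d : ℂ)⁻¹)) =
        s.rep (chart s) * s.rep l * (d : ℂ)⁻¹ * (ρ l - ρ (chart s)) := by ring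
    rw [h2]
    exact mul_ne_zero (mul_ne_zero (mul_ne_zero (hv _) (hv _)) hd')
      (sub_ne_zero.2 (hinj.ne hl))

/-- A point of the Fermat curve on a coordinate line is an inflection point. -/
theorem exists_isHyperosculating_of_rep_eq_zero {d : ℕ} (hd : 3 < d) (s : P2)
    (hs : ∑ j, s.rep j ^ d = 0) (k : Fin 3) (hk : s.rep k = 0) :
    ∃ T : PlaneCurve 1, IsHyperosculating (fermatCurve d) s T := by
  have hki : k ≠ chart s := fun h => chart_spec s (h ▸ hk)
  obtain ⟨j, hjk, hji⟩ : ∃ j, j ≠ k ∧ j ≠ chart s := by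
    generalize chart s = i
    clear hk hki
    revert k i; decide
  set i := chart s with hi
  have hvi : s.rep i ≠ 0 := chart_spec s
  have hd0 : d ≠ 0 := by omega
  have hs' : s.rep i ^ d + s.rep j ^ d = 0 := by
    rw [sum_eq_of_ne hji.symm hki.symm hjk, hk, zero_pow hd0, add_zero] at hs
    exact hs
  have hvj : s.rep j ≠ 0 := fun h => by
    rw [h, zero_pow hd0, add_zero] at hs'
    exact pow_ne_zero d hvi hs'
  set f : homogeneousSubmodule (Fin 3) ℂ 1 := ⟨C (s.rep j) * X i - C (s.rep i) * X j,
    (mem_homogeneousSubmodule _ _).2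
      ((isHomogeneous_C_mul_X _ _).sub (isHomogeneous_C_mul_X _ _))⟩ with hf
  have hf0 : f ≠ 0 := by
    intro h
    have h1 : C (s.rep j) * X i - C (s.rep i) * X j = (0 : MvPolynomial (Fin 3) ℂ) :=
      congrArg Subtype.val h
    have h2 := congrArg (eval (fun l => if l = i then (1 : ℂ) else 0)) h1
    simp [hji, hvj] at h2
  obtain ⟨a, ha, hform⟩ := PlaneCurve.exists_form_mk f hf0
  refine ⟨Projectivization.mk ℂ f hf0, ?_⟩
  -- The approximate branch `(v_i, v_j, t)` satisfies the equation only up to `t ^ d`, which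
  -- suffices for contact of order three. The line `v_j x_i = v_i x_j` vanishes on it identically.
  set γ : Fin 3 → PowerSeries ℂ := fun l => if l = k then PowerSeries.X else
    PowerSeries.C (s.rep l) with hγ
  have hγk : γ k = PowerSeries.X := by simp [hγ]
  have hγi : γ i = PowerSeries.C (s.rep i) := by simp [hγ, hki.symm]
  have hγj : γ j = PowerSeries.C (s.rep j) := by simp [hγ, hjk]
  have := (le_intersectionMultiplicity_fermatCurve_iff (n := 1) hd0 (Projectivization.mk ℂ f hf0) s
    hs γ (fun l => by by_cases h : l = k <;> simp [hγ, h, hk]) (N := 3) ?_ k j hki hji hjk.symm hvj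
    ?_ 3 le_rfl).2 ?_
  · refine lt_of_lt_of_le ?_ this
    norm_num
  · rw [sum_eq_of_ne hji.symm hki.symm hjk, hγi, hγj, hγk, ← map_pow, ← map_pow, ← map_add, hs',
      map_zero, zero_add]
    exact pow_dvd_pow _ (by omega)
  · rw [← hi, hγk, hk, PowerSeries.coeff_one_X]
    simpa using hvi
  · rw [hform, hf]
    simp only [map_mul, map_sub, aeval_X, hγi, hγj, aeval_C, ← PowerSeries.C_eq_algebraMap]
    rw [mul_comm (PowerSeries.C (s.rep j)), sub_self, mul_zero]
    exact dvd_zero _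

/-- The weights `v_{j+1}^d - v_{j+2}^d` of the standard branch at a point of the Fermat curve. -/
def standardWeight (d : ℕ) (v : Fin 3 → ℂ) : Fin 3 → ℂ :=
  ![v 1 ^ d - v 2 ^ d, v 2 ^ d - v 0 ^ d, v 0 ^ d - v 1 ^ d]

/-- By the equation of the curve, the difference of two weights is `±3` times the `d`-th power of
the remaining coordinate. -/
theorem standardWeight_injective {d : ℕ} {v : Fin 3 → ℂ} (hs : ∑ j, v j ^ d = 0)
    (hv : ∀ j, v j ≠ 0) : Function.Injective (standardWeight d v) := by
  have h0 := pow_ne_zero d (hv 0)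
  have h1 := pow_ne_zero d (hv 1)
  have h2 := pow_ne_zero d (hv 2)
  rw [Fin.sum_univ_three] at hs
  have e01 : standardWeight d v 0 ≠ standardWeight d v 1 := fun h => h2 (by
    simp only [standardWeight, Matrix.cons_val] at h
    linear_combination (hs - h) / 3)
  have e02 : standardWeight d v 0 ≠ standardWeight d v 2 := fun h => h1 (by
    simp only [standardWeight, Matrix.cons_val] at h
    linear_combination (hs + h) / 3)
  have e12 : standardWeight d v 1 ≠ standardWeight d v 2 := fun h => h0 (by
    simp only [standardWeight, Matrix.cons_val] at h
    linear_combination (hs - h) / 3)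
  intro a b h
  fin_cases a <;> fin_cases b
  exacts [rfl, absurd h e01, absurd h e02, absurd h.symm e01, rfl, absurd h e12,
    absurd h.symm e02, absurd h.symm e12, rfl]

theorem sum_mul_standardWeight (d : ℕ) (v : Fin 3 → ℂ) :
    ∑ j, v j ^ d * standardWeight d v j = 0 := by
  simp only [Fin.sum_univ_three, standardWeight, Matrix.cons_val]
  ring

/-- The tangent line at `s` is `∑ s_j ^ (d - 1) X_j = 0`. -/
theorem isTangentLine_iff {d : ℕ} (hd : d ≠ 0) (T : PlaneCurve 1) (s : P2)
    (hs : ∑ j, s.rep j ^ d = 0) (hv : ∀ j, s.rep j ≠ 0) :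
    IsTangentLine (fermatCurve d) s T ↔
      ∃ κ : ℂ, T.form = C κ * ∑ j, C (s.rep j ^ d * (s.rep j)⁻¹) * X j := by
  set v := s.rep with hvdef
  have hd' : (d : ℂ)⁻¹ ≠ 0 := inv_ne_zero (Nat.cast_ne_zero.2 hd)
  have hiff := le_intersectionMultiplicity_iff_fermatBranch hd T s hs hv _
    (sum_mul_standardWeight d v) (standardWeight_injective hs hv) 2
  have hdef : IsTangentLine (fermatCurve d) s T ↔
      PowerSeries.X ^ 2 ∣ aeval (fermatBranch d v (standardWeight d v)) T.form := hiff
  rw [hdef]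
  obtain ⟨a, b, c, hf⟩ := exists_linear_coeffs (i := 0) (j := 1) (k := 2) (by decide) (by decide)
    (by decide) T.isHomogeneous_form
  set ρ := standardWeight d v with hρ
  have hcoeff : ∀ n j (x : ℂ), PowerSeries.coeff n (PowerSeries.C x * fermatBranch d v ρ j) =
      x * v j * (ρ j ^ n * Ring.choose (d : ℂ)⁻¹ n) := by
    intro n j x
    rw [fermatBranch, PowerSeries.coeff_C_mul, PowerSeries.coeff_C_mul, coeff_powSeries]
    ring
  have hae : aeval (fermatBranch d v ρ) T.form = PowerSeries.C a * fermatBranch d v ρ 0 +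
      PowerSeries.C b * fermatBranch d v ρ 1 + PowerSeries.C c * fermatBranch d v ρ 2 := by
    rw [hf]
    simp only [map_add, map_mul, aeval_X, aeval_C, ← PowerSeries.C_eq_algebraMap]
  have hX : PowerSeries.X ^ 2 ∣ aeval (fermatBranch d v ρ) T.form ↔
      a * v 0 + b * v 1 + c * v 2 = 0 ∧ a * v 0 * ρ 0 + b * v 1 * ρ 1 + c * v 2 * ρ 2 = 0 := by
    rw [hae, PowerSeries.X_pow_dvd_iff]
    constructor
    · intro h
      have h0 := h 0 (by norm_num)
      have h1 := h 1 (by norm_num)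
      rw [map_add, map_add, hcoeff, hcoeff, hcoeff, Ring.choose_zero_right] at h0
      rw [map_add, map_add, hcoeff, hcoeff, hcoeff, Ring.choose_one_right] at h1
      refine ⟨by linear_combination h0, mul_left_cancel₀ hd' ?_⟩
      linear_combination h1
    · rintro ⟨h0, h1⟩ m hm
      rw [map_add, map_add, hcoeff, hcoeff, hcoeff]
      interval_cases m
      · rw [Ring.choose_zero_right]
        linear_combination h0
      · rw [Ring.choose_one_right]
        linear_combination (d : ℂ)⁻¹ * h1
  rw [hX]
  have h0 := hv 0
  have h1 := hv 1
  have h2 := hv 2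
  rw [Fin.sum_univ_three] at hs
  have hρ0 : ρ 0 = v 1 ^ d - v 2 ^ d := rfl
  have hρ1 : ρ 1 = v 2 ^ d - v 0 ^ d := rfl
  have hρ2 : ρ 2 = v 0 ^ d - v 1 ^ d := rfl
  have p0 := pow_ne_zero d h0
  rw [hρ0, hρ1, hρ2]
  constructor
  · rintro ⟨e0, e1⟩
    -- The vector `(a v_0, b v_1, c v_2)` is orthogonal to `(1, 1, 1)` and to `ρ`. So is `(v_0 ^ d,
    -- v_1 ^ d, v_2 ^ d)`, hence the two are proportional.
    have hb : b * v 1 * v 0 ^ d = a * v 0 * v 1 ^ d := by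
      linear_combination (-1 / 3) * (e1 - (v 0 ^ d - v 1 ^ d) * e0 + (a * v 0 - b * v 1) * hs)
    have hc : c * v 2 * v 0 ^ d = a * v 0 * v 2 ^ d := by
      linear_combination (1 / 3) * (e1 - (v 2 ^ d - v 0 ^ d) * e0 + (c * v 2 - a * v 0) * hs)
    refine ⟨a * v 0 / v 0 ^ d, ?_⟩
    have hb' : b = a * v 0 / v 0 ^ d * (v 1 ^ d * (v 1)⁻¹) := by
      field_simp
      linear_combination hb
    have hc' : c = a * v 0 / v 0 ^ d * (v 2 ^ d * (v 2)⁻¹) := by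
      field_simp
      linear_combination hc
    have ha' : a = a * v 0 / v 0 ^ d * (v 0 ^ d * (v 0)⁻¹) := by
      field_simp
    rw [hf, Fin.sum_univ_three, mul_add, mul_add, ← mul_assoc, ← mul_assoc, ← mul_assoc, ← C_mul,
      ← C_mul, ← C_mul, ← ha', ← hb', ← hc']
  · rintro ⟨κ, hκ⟩
    have hcomp : ∀ w : Fin 3 → ℂ, a * w 0 + b * w 1 + c * w 2 =
        κ * (v 0 ^ d * (v 0)⁻¹ * w 0 + v 1 ^ d * (v 1)⁻¹ * w 1 + v 2 ^ d * (v 2)⁻¹ * w 2) := by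
      intro w
      have := congrArg (eval w) (hf.symm.trans hκ)
      simpa [Fin.sum_univ_three] using this
    constructor
    · rw [hcomp v]
      field_simp
      linear_combination κ * hs
    · have := hcomp ![v 0 * (v 1 ^ d - v 2 ^ d), v 1 * (v 2 ^ d - v 0 ^ d),
        v 2 * (v 0 ^ d - v 1 ^ d)]
      simp only [Matrix.cons_val] at this
      have h3 : κ * (v 0 ^ d * (v 0)⁻¹ * (v 0 * (v 1 ^ d - v 2 ^ d)) +
        v 1 ^ d * (v 1)⁻¹ * (v 1 * (v 2 ^ d - v 0 ^ d)) +
        v 2 ^ d * (v 2)⁻¹ * (v 2 * (v 0 ^ d - v 1 ^ d))) = 0 := by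
        field_simp
        ring
      rw [h3] at this
      linear_combination this

theorem conic_contact_equations {d : ℕ} (hd : d ≠ 0) (O : PlaneCurve 2) (s : P2)
    (hs : ∑ j, s.rep j ^ d = 0) (hv : ∀ j, s.rep j ≠ 0) (ρ : Fin 3 → ℂ)
    (hρ : ∑ j, s.rep j ^ d * ρ j = 0) (hinj : Function.Injective ρ)
    (hO : IsHyperosculatingConic (fermatCurve d) s O) (i j k : Fin 3) (a b c u v w : ℂ)
    (hf : O.form = C a * X i ^ 2 + C b * X j ^ 2 + C c * X k ^ 2 +
      C u * (X j * X k) + C v * (X i * X k) + C w * (X i * X j)) (n : ℕ) (hn : n < 6) :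
    a * s.rep i ^ 2 * prodCoeff (d : ℂ)⁻¹ (ρ i) (ρ i) n +
    b * s.rep j ^ 2 * prodCoeff (d : ℂ)⁻¹ (ρ j) (ρ j) n +
    c * s.rep k ^ 2 * prodCoeff (d : ℂ)⁻¹ (ρ k) (ρ k) n +
    u * (s.rep j * s.rep k) * prodCoeff (d : ℂ)⁻¹ (ρ j) (ρ k) n +
    v * (s.rep i * s.rep k) * prodCoeff (d : ℂ)⁻¹ (ρ i) (ρ k) n +
    w * (s.rep i * s.rep j) * prodCoeff (d : ℂ)⁻¹ (ρ i) (ρ j) n = 0 := by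
  -- For `n = 2` the bound `n * (n + 3) / 2` is `5`, and exceeding it strictly means at least `6`.
  have h6 : ((6 : ℕ) : ℕ∞) ≤ intersectionMultiplicity (fermatCurve d) O s := by
    have h := Order.add_one_le_of_lt hO
    norm_num at h ⊢
    exact h
  rw [le_intersectionMultiplicity_iff_fermatBranch hd O s hs hv ρ hρ hinj,
    PowerSeries.X_pow_dvd_iff] at h6
  have h := h6 n hn
  have hcoeff : ∀ (x : ℂ) (p q : Fin 3), PowerSeries.coeff n (PowerSeries.C x *
      (fermatBranch d s.rep ρ p * fermatBranch d s.rep ρ q)) =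
      x * (s.rep p * s.rep q) * prodCoeff (d : ℂ)⁻¹ (ρ p) (ρ q) n := by
    intro x p q
    have : PowerSeries.C x * (fermatBranch d s.rep ρ p * fermatBranch d s.rep ρ q) =
        PowerSeries.C (x * (s.rep p * s.rep q)) *
          (powSeries (d : ℂ)⁻¹ (ρ p) * powSeries (d : ℂ)⁻¹ (ρ q)) := by
      rw [fermatBranch, fermatBranch, map_mul, map_mul]
      ring
    rw [this, PowerSeries.coeff_C_mul, prodCoeff]
  rw [hf] at h
  simp only [map_add, map_mul, aeval_X, aeval_C, ← PowerSeries.C_eq_algebraMap, pow_two] at h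
  rw [hcoeff, hcoeff, hcoeff, hcoeff, hcoeff, hcoeff] at h
  simpa only [pow_two] using h

theorem vandermonde_three {α β γ x y z : ℂ} (hαβ : α ≠ β) (hαγ : α ≠ γ) (hβγ : β ≠ γ)
    (h0 : x + y + z = 0) (h1 : x * α + y * β + z * γ = 0)
    (h2 : x * α ^ 2 + y * β ^ 2 + z * γ ^ 2 = 0) : x = 0 ∧ y = 0 ∧ z = 0 := by
  refine ⟨?_, ?_, ?_⟩
  · refine (mul_eq_zero.1 (?_ : (α - β) * (α - γ) * x = 0)).resolve_left
      (mul_ne_zero (sub_ne_zero.2 hαβ) (sub_ne_zero.2 hαγ))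
    linear_combination h2 - (β + γ) * h1 + β * γ * h0
  · refine (mul_eq_zero.1 (?_ : (α - β) * (β - γ) * y = 0)).resolve_left
      (mul_ne_zero (sub_ne_zero.2 hαβ) (sub_ne_zero.2 hβγ))
    linear_combination -h2 + (α + γ) * h1 - α * γ * h0
  · refine (mul_eq_zero.1 (?_ : (α - γ) * (β - γ) * z = 0)).resolve_left
      (mul_ne_zero (sub_ne_zero.2 hαγ) (sub_ne_zero.2 hβγ))
    linear_combination h2 - (α + β) * h1 + α * β * h0

theorem inv_natCast_ne {d : ℕ} (hd : 3 < d) : (d : ℂ)⁻¹ ≠ 0 ∧ (d : ℂ)⁻¹ ≠ 1 ∧ (d : ℂ)⁻¹ ≠ 2 ∧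
    2 * (d : ℂ)⁻¹ - 1 ≠ 0 := by
  have h0 : (d : ℂ) ≠ 0 := Nat.cast_ne_zero.2 (by omega)
  refine ⟨inv_ne_zero h0, fun h => ?_, fun h => ?_, fun h => ?_⟩
  · field_simp at h
    have : d = 1 := by exact_mod_cast h.symm
    omega
  · field_simp at h
    have : 1 = d * 2 := by exact_mod_cast h
    omega
  · field_simp at h
    have : (2 : ℂ) = d := by linear_combination h
    have : 2 = d := by exact_mod_cast this
    omega

theorem IsSextacticPoint.sum_rep_pow {d : ℕ} {s : P2} (h : IsSextacticPoint (fermatCurve d) s) :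
    ∑ j, s.rep j ^ d = 0 := by
  obtain ⟨a, ha, hform⟩ := exists_fermatCurve_form d
  have := eval_rep_eq_zero_of_isSmoothPoint _ _ h.1
  rw [hform, map_mul, eval_C, map_sum] at this
  simpa [ha] using this

theorem IsSextacticPoint.rep_ne_zero {d : ℕ} (hd : 3 < d) {s : P2}
    (h : IsSextacticPoint (fermatCurve d) s) (j : Fin 3) : s.rep j ≠ 0 := fun h0 =>
  h.2.1 ⟨h.1, exists_isHyperosculating_of_rep_eq_zero hd s h.sum_rep_pow j h0⟩

/-- At a sextactic point, two of `x ^ d`, `y ^ d`, `z ^ d` agree. -/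
theorem IsSextacticPoint.exists_pow_eq {d : ℕ} (hd : 3 < d) {s : P2}
    (h : IsSextacticPoint (fermatCurve d) s) : ∃ k, standardWeight d s.rep k = 0 := by
  obtain ⟨O, hO⟩ := h.2.2
  have hs := h.sum_rep_pow
  have hv := h.rep_ne_zero hd
  have hd0 : d ≠ 0 := by omega
  have hinj := standardWeight_injective hs hv
  set ρ := standardWeight d s.rep with hρ
  obtain ⟨m0, m1, m2, m3⟩ := inv_natCast_ne hd
  obtain ⟨a, b, c, u, v, w, hf⟩ := exists_conic_coeffs (i := 0) (j := 1) (k := 2) (by decide)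
    (by decide) (by decide) O.isHomogeneous_form
  have heq := conic_contact_equations hd0 O s hs hv ρ (sum_mul_standardWeight d s.rep) hinj hO
    0 1 2 a b c u v w hf
  -- If no weight vanishes, neither does their product `p`. Then all moments of the conic vanish,
  -- and by Vandermonde so do all its coefficients.
  by_contra! hcon
  have hsum : ρ 0 + ρ 1 + ρ 2 = 0 := by
    simp only [hρ, standardWeight, Matrix.cons_val]
    ring
  have hmom := conic_moments _ _ _ _ _ _ _ _ _ _ hsum heq _ _ _ _ _ _ _ _ rfl rfl rfl rfl rfl rfl
    rfl rfl
  obtain ⟨r0, r1, r2, r3, r4, r5⟩ := moments_reduce _ _ _ _ _ _ _ _ _ m0 m1 m2 hmom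
  have h01 : ρ 0 ≠ ρ 1 := hinj.ne (by decide)
  have h02 : ρ 0 ≠ ρ 2 := hinj.ne (by decide)
  have h12 : ρ 1 ≠ ρ 2 := hinj.ne (by decide)
  have hγ : ρ 2 = -ρ 0 - ρ 1 := by linear_combination hsum
  -- Up to sign this is the discriminant of the cubic with roots `ρ_j`, the square of their
  -- Vandermonde product.
  have hdisc : 27 * (ρ 0 * ρ 1 * ρ 2) ^ 2 + 4 * (ρ 0 * ρ 1 + ρ 1 * ρ 2 + ρ 2 * ρ 0) ^ 3 ≠ 0 := by
    have : 27 * (ρ 0 * ρ 1 * ρ 2) ^ 2 + 4 * (ρ 0 * ρ 1 + ρ 1 * ρ 2 + ρ 2 * ρ 0) ^ 3 =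
        -((ρ 0 - ρ 1) * (ρ 0 - ρ 2) * (ρ 1 - ρ 2)) ^ 2 := by
      rw [hγ]; ring
    rw [this]
    exact neg_ne_zero.2 (pow_ne_zero _ (mul_ne_zero (mul_ne_zero (sub_ne_zero.2 h01)
      (sub_ne_zero.2 h02)) (sub_ne_zero.2 h12)))
  obtain ⟨e0, e1, e2⟩ := moments_eq_zero _ _ _ _ _ _ m1 m3
    (mul_ne_zero (mul_ne_zero (hcon 0) (hcon 1)) (hcon 2)) hdisc r3 r4 r5
  obtain ⟨ha, hb, hc⟩ := vandermonde_three h01 h02 h12 e0 e1 e2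
  have hm1 : (d : ℂ)⁻¹ + 1 ≠ 0 := by
    have h0 : (d : ℂ) ≠ 0 := Nat.cast_ne_zero.2 hd0
    intro h
    field_simp at h
    have : 1 + d = 0 := by exact_mod_cast h
    omega
  rw [e0, neg_zero] at r0
  rw [e1, mul_zero] at r1
  rw [e0, e2, mul_zero, mul_zero, sub_zero, mul_zero] at r2
  obtain ⟨hu, hv', hw⟩ := vandermonde_three h01 h02 h12 r0 r1
    ((mul_eq_zero.1 r2).resolve_left hm1)
  have hz : ∀ {x y : ℂ}, y ≠ 0 → x * y = 0 → x = 0 := fun hy h => (mul_eq_zero.1 h).resolve_right hy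
  apply O.form_ne_zero
  rw [hf, hz (pow_ne_zero 2 (hv 0)) ha, hz (pow_ne_zero 2 (hv 1)) hb, hz (pow_ne_zero 2 (hv 2)) hc,
    hz (mul_ne_zero (hv 1) (hv 2)) hu, hz (mul_ne_zero (hv 0) (hv 2)) hv',
    hz (mul_ne_zero (hv 0) (hv 1)) hw]
  simp

/-- The form of the hyperosculating conic at the point `v` of the Fermat curve
with `v_i ^ d = v_j ^ d`. -/
noncomputable def sextacticForm (d : ℕ) (v : Fin 3 → ℂ) (i j k : Fin 3) : MvPolynomial (Fin 3) ℂ :=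
  C (d * (d + 1) * (v i)⁻¹ ^ 2) * X i ^ 2 + C (d * (d + 1) * (v j)⁻¹ ^ 2) * X j ^ 2 +
  C (-4 * (d + 1) * (2 * d - 3) * (v k)⁻¹ ^ 2) * X k ^ 2 +
  C (8 * d * (d - 2) * ((v j)⁻¹ * (v k)⁻¹)) * (X j * X k) +
  C (8 * d * (d - 2) * ((v i)⁻¹ * (v k)⁻¹)) * (X i * X k) +
  C (-2 * (d - 2) * (5 * d - 3) * ((v i)⁻¹ * (v j)⁻¹)) * (X i * X j)

/-- When `v_i ^ d = v_j ^ d` the weights `(1, -1, 0)` are admissible, giving `p = 0` and `s = -1`.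
The order-three equation makes the conic symmetric in the normalized coordinates `x_i / v_i` and
`x_j / v_j`, the order-five equation becomes redundant, and the others determine all coefficients
from one of them. -/
theorem exists_form_eq_sextacticForm {d : ℕ} (hd : 3 < d) (O : PlaneCurve 2) (s : P2)
    (hs : ∑ j, s.rep j ^ d = 0) (hv : ∀ j, s.rep j ≠ 0)
    (hO : IsHyperosculatingConic (fermatCurve d) s O) {i j k : Fin 3} (hij : i ≠ j) (hik : i ≠ k)
    (hjk : j ≠ k) (hpow : s.rep i ^ d = s.rep j ^ d) :
    ∃ κ : ℂ, κ ≠ 0 ∧ O.form = C κ * sextacticForm d s.rep i j k := by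
  have hd0 : d ≠ 0 := by omega
  have hdc : (d : ℂ) ≠ 0 := Nat.cast_ne_zero.2 hd0
  have hd1 : (d : ℂ) + 1 ≠ 0 := by exact_mod_cast Nat.succ_ne_zero d
  obtain ⟨m0, m1, m2, m3⟩ := inv_natCast_ne hd
  set ρ : Fin 3 → ℂ := fun l => if l = i then 1 else if l = j then -1 else 0 with hρ
  have hi : ρ i = 1 := by simp [hρ]
  have hj : ρ j = -1 := by simp [hρ, hij.symm]
  have hk : ρ k = 0 := by simp [hρ, hik.symm, hjk.symm]
  have hinj : Function.Injective ρ := by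
    intro x y
    refine forall_of_ne (P := fun x => ρ x = ρ y → x = y) hij hik hjk ?_ ?_ ?_ x <;>
    refine forall_of_ne (P := fun y => ρ _ = ρ y → _ = y) hij hik hjk ?_ ?_ ?_ y <;>
    norm_num [hi, hj, hk]
  have hρ0 : ∑ l, s.rep l ^ d * ρ l = 0 := by
    rw [sum_eq_of_ne hij hik hjk, hi, hj, hk, hpow]
    ring
  obtain ⟨a, b, c, u, v, w, hf⟩ := exists_conic_coeffs hij hik hjk O.isHomogeneous_form
  have heq := conic_contact_equations hd0 O s hs hv ρ hρ0 hinj hO i j k a b c u v w hf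
  rw [hi, hj, hk] at heq
  have hmom := conic_moments _ _ _ _ _ _ _ _ _ _ (by norm_num) heq _ _ _ _ _ _ _ _ rfl rfl rfl rfl
    rfl rfl rfl rfl
  obtain ⟨r0, r1, r2, r3, r4, r5⟩ := moments_reduce _ _ _ _ _ _ _ _ _ m0 m1 m2 hmom
  set v1 := s.rep i with hv1
  set v2 := s.rep j with hv2
  set v3 := s.rep k with hv3
  have n1 : v1 ≠ 0 := hv i
  have n2 : v2 ≠ 0 := hv j
  have n3 : v3 ≠ 0 := hv k
  set A := a * v1 ^ 2 with hA
  set B := b * v2 ^ 2 with hB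
  set G := c * v3 ^ 2 with hG
  set U := u * (v2 * v3) with hU
  set V := v * (v1 * v3) with hV
  set W := w * (v1 * v2) with hW
  have hBA : B = A := by linear_combination -r3 / 2
  rw [hBA] at r0 r1 r2 r4
  have hVU : V = U := by linear_combination -r1
  rw [hVU] at r0 r2
  have hG' : G = A * (12 * (d : ℂ)⁻¹ - 8) := by linear_combination -r4
  rw [hG'] at r0 r2
  have hU' : ((d : ℂ)⁻¹ + 1) * U = -(16 * (d : ℂ)⁻¹ - 8) * A := by linear_combination r2 / 2
  have hU'' : (d + 1) * U = -(16 - 8 * d) * A := by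
    have : (d : ℂ) * (d : ℂ)⁻¹ = 1 := mul_inv_cancel₀ hdc
    linear_combination d * hU' - (U + 16 * A) * this
  have hU3 : U = 8 * d * (d - 2) * (A / (d * (d + 1))) := by
    field_simp
    linear_combination hU''
  have hG3 : G = -4 * (d + 1) * (2 * d - 3) * (A / (d * (d + 1))) := by
    rw [hG']
    field_simp
    ring
  have hW3 : W = -2 * (d - 2) * (5 * d - 3) * (A / (d * (d + 1))) := by
    have : W = -2 * U - (12 * (d : ℂ)⁻¹ - 6) * A := by linear_combination r0
    rw [this, hU3]
    field_simp
    ring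
  -- This scaling clears the denominators coming from `m = 1 / d` and `m + 1`.
  set κ := A / (d * (d + 1)) with hκ
  have hA3 : A = d * (d + 1) * κ := by
    rw [hκ]
    field_simp
  have ea : a = κ * (d * (d + 1) * v1⁻¹ ^ 2) := by
    field_simp
    linear_combination hA3
  have eb : b = κ * (d * (d + 1) * v2⁻¹ ^ 2) := by
    field_simp
    linear_combination hA3 + hBA
  have ec : c = κ * (-4 * (d + 1) * (2 * d - 3) * v3⁻¹ ^ 2) := by
    field_simp
    linear_combination hG3
  have eu : u = κ * (8 * d * (d - 2) * (v2⁻¹ * v3⁻¹)) := by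
    field_simp
    linear_combination hU3
  have ev : v = κ * (8 * d * (d - 2) * (v1⁻¹ * v3⁻¹)) := by
    field_simp
    linear_combination hU3 + hVU
  have ew : w = κ * (-2 * (d - 2) * (5 * d - 3) * (v1⁻¹ * v2⁻¹)) := by
    field_simp
    linear_combination hW3
  have hfin : O.form = C κ * sextacticForm d s.rep i j k := by
    rw [hf, sextacticForm, ← hv1, ← hv2, ← hv3]
    rw [ea, eb, ec, eu, ev, ew]
    simp only [C_mul]
    ring
  refine ⟨κ, fun h0 => O.form_ne_zero ?_, hfin⟩
  rw [hfin, h0, C_0, zero_mul]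

/-! ### Irreducible forms and multiplicities of unions -/

theorem exists_affine_coeffs {f : MvPolynomial (Fin 3) ℂ} (hf : f.totalDegree = 1) :
    ∃ e a b c : ℂ, f = C e + (C a * X 0 + C b * X 1 + C c * X 2) := by
  have h := sum_homogeneousComponent f
  rw [hf, Finset.sum_range_succ, Finset.sum_range_one, homogeneousComponent_zero] at h
  obtain ⟨a, b, c, habc⟩ := exists_linear_coeffs (i := 0) (j := 1) (k := 2) (by decide)
    (by decide) (by decide) (homogeneousComponent_isHomogeneous 1 f)
  exact ⟨_, a, b, c, by rw [← habc, h]⟩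

theorem isUnit_of_totalDegree_eq_zero {f : MvPolynomial (Fin 3) ℂ} (hf : f ≠ 0)
    (h : f.totalDegree = 0) : IsUnit f := by
  rw [totalDegree_eq_zero_iff_eq_C] at h
  rw [h]
  refine (isUnit_iff_ne_zero.2 fun h0 => hf ?_).map C
  rw [h, h0, C_0]

/-- A quadratic form without nonzero period is irreducible. -/
theorem irreducible_of_forall_period {f : MvPolynomial (Fin 3) ℂ} (hf : f.IsHomogeneous 2)
    (hf0 : f ≠ 0) (hper : ∀ w : Fin 3 → ℂ, (∀ x, eval (x + w) f = eval x f) → w = 0) :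
    Irreducible f := by
  have hdeg := hf.totalDegree hf0
  refine ⟨fun hu => ?_, fun g h hgh => ?_⟩
  · have := (MvPolynomial.isUnit_iff_totalDegree_of_isReduced.mp hu).2
    omega
  · have hg0 : g ≠ 0 := by rintro rfl; exact hf0 (by rw [hgh, zero_mul])
    have hh0 : h ≠ 0 := by rintro rfl; exact hf0 (by rw [hgh, mul_zero])
    have hsum : g.totalDegree + h.totalDegree = 2 := by
      rw [← totalDegree_mul_of_isDomain hg0 hh0, ← hgh, hdeg]
    rcases (by omega : g.totalDegree = 0 ∨ h.totalDegree = 0 ∨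
      (g.totalDegree = 1 ∧ h.totalDegree = 1)) with h1 | h1 | ⟨h1, h2⟩
    · exact Or.inl (isUnit_of_totalDegree_eq_zero hg0 h1)
    · exact Or.inr (isUnit_of_totalDegree_eq_zero hh0 h1)
    · exfalso
      obtain ⟨e, a, b, c, hg⟩ := exists_affine_coeffs h1
      obtain ⟨e', a', b', c', hh⟩ := exists_affine_coeffs h2
      -- The linear parts of the two factors have a common zero `w ≠ 0` in three-space. Translation
      -- by `w` fixes both factors, whatever their constant terms, so `w` is a period of the
      -- product.
      have hker := LinearMap.ker_ne_bot_of_finrank_lt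
        (f := Matrix.mulVecLin !![a, b, c; a', b', c']) (by simp)
      obtain ⟨w, hw, hw0⟩ := (Submodule.ne_bot_iff _).1 hker
      have hw1 := congrFun (LinearMap.mem_ker.1 hw) 0
      have hw2 := congrFun (LinearMap.mem_ker.1 hw) 1
      simp [Matrix.mulVec, dotProduct, Fin.sum_univ_three] at hw1 hw2
      refine hw0 (hper w fun x => ?_)
      rw [hgh, hg, hh]
      simp only [map_mul, map_add, eval_C, eval_X, Pi.add_apply]
      linear_combination (e' + (a' * x 0 + b' * x 1 + c' * x 2)) * hw1 +
        (e + (a * (x 0 + w 0) + b * (x 1 + w 1) + c * (x 2 + w 2))) * hw2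

theorem PlaneCurve.irreducible_form_of_degree_one (T : PlaneCurve 1) : Irreducible T.form := by
  have hdeg := T.isHomogeneous_form.totalDegree T.form_ne_zero
  refine ⟨fun hu => ?_, fun g h hgh => ?_⟩
  · have := (MvPolynomial.isUnit_iff_totalDegree_of_isReduced.mp hu).2
    omega
  · have hg0 : g ≠ 0 := by rintro rfl; exact T.form_ne_zero (by rw [hgh, zero_mul])
    have hh0 : h ≠ 0 := by rintro rfl; exact T.form_ne_zero (by rw [hgh, mul_zero])
    have hsum : g.totalDegree + h.totalDegree = 1 := by
      rw [← totalDegree_mul_of_isDomain hg0 hh0, ← hgh, hdeg]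
    rcases (by omega : g.totalDegree = 0 ∨ h.totalDegree = 0) with h1 | h1
    · exact Or.inl (isUnit_of_totalDegree_eq_zero hg0 h1)
    · exact Or.inr (isUnit_of_totalDegree_eq_zero hh0 h1)

theorem squarefree_prod_of_irreducible {ι : Type*} (S : Finset ι)
    (f : ι → MvPolynomial (Fin 3) ℂ) (hirr : ∀ s ∈ S, Irreducible (f s))
    (hne : ∀ s ∈ S, ∀ t ∈ S, s ≠ t → ¬ Associated (f s) (f t)) : Squarefree (∏ s ∈ S, f s) := by
  classical
  induction S using Finset.induction_on with
  | empty => simp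
  | insert a S ha ih =>
    rw [Finset.prod_insert ha, squarefree_mul_iff]
    have hirr' : ∀ s ∈ S, Irreducible (f s) := fun s hs => hirr s (Finset.mem_insert_of_mem hs)
    refine ⟨?_, (hirr a (Finset.mem_insert_self _ _)).squarefree, ih hirr' fun s hs t ht =>
      hne s (Finset.mem_insert_of_mem hs) t (Finset.mem_insert_of_mem ht)⟩
    have hia := hirr a (Finset.mem_insert_self _ _)
    rw [hia.isRelPrime_iff_not_dvd]
    intro hdvd
    obtain ⟨s, hs, hdvd⟩ := (hia.prime.dvd_finsetProd_iff _).1 hdvd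
    exact hne a (Finset.mem_insert_self _ _) s (Finset.mem_insert_of_mem hs)
      (fun h => ha (h ▸ hs)) (hia.associated_of_dvd (hirr' s hs) hdvd)

theorem PlaneCurve.eq_of_associated {n : ℕ} (Γ Δ : PlaneCurve n)
    (h : Associated Γ.form Δ.form) : Γ = Δ := by
  obtain ⟨u, hu⟩ := h.symm
  have hdeg := (MvPolynomial.isUnit_iff_totalDegree_of_isReduced.mp u.isUnit).2
  rw [totalDegree_eq_zero_iff_eq_C] at hdeg
  exact Γ.eq_of_form Δ _ (by rw [← hu, mul_comm, ← hdeg])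

/-- A union of irreducible curves that are smooth at `q`, as many as their number. -/
theorem isFoldPoint_biUnion {n : ℕ} (S : Finset P2) (Γ : P2 → PlaneCurve n)
    (hirr : ∀ s ∈ S, Irreducible (Γ s).form) (hinj : Set.InjOn Γ S) (q : P2)
    (hq : ∀ s ∈ S, multiplicityAt (Γ s) q = 1) :
    IsFoldPoint S.card (⋃ s ∈ S, (Γ s).points) q := by
  have hhom : (∏ s ∈ S, (Γ s).form).IsHomogeneous (∑ _s ∈ S, n) :=
    IsHomogeneous.prod S _ _ fun s _ => (Γ s).isHomogeneous_form
  have hne0 : ∏ s ∈ S, (Γ s).form ≠ 0 := Finset.prod_ne_zero_iff.2 fun s _ => (Γ s).form_ne_zero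
  set f : homogeneousSubmodule (Fin 3) ℂ (∑ _s ∈ S, n) :=
    ⟨∏ s ∈ S, (Γ s).form, (mem_homogeneousSubmodule _ _).2 hhom⟩ with hf
  have hf0 : f ≠ 0 := fun h => hne0 (congrArg Subtype.val h)
  obtain ⟨a, ha, hform⟩ := PlaneCurve.exists_form_mk f hf0
  replace hform : PlaneCurve.form (Projectivization.mk ℂ f hf0) =
    C a * ∏ s ∈ S, (Γ s).form := hform
  have hCu : IsUnit (C a : MvPolynomial (Fin 3) ℂ) := (isUnit_iff_ne_zero.2 ha).map C
  refine ⟨_, Projectivization.mk ℂ f hf0, ?_, ?_, ?_⟩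
  · rw [hform]
    refine squarefree_mul_iff.2 ⟨hCu.isRelPrime_left, hCu.squarefree, ?_⟩
    exact squarefree_prod_of_irreducible S _ hirr fun s hs t ht hst hass =>
      hst (hinj hs ht (PlaneCurve.eq_of_associated _ _ hass))
  · ext p
    simp only [PlaneCurve.points, Set.mem_ofPred_eq, Set.mem_iUnion, hform, map_mul, eval_C,
      map_prod, mul_eq_zero, ha, false_or, Finset.prod_eq_zero_iff, exists_prop]
  · rw [multiplicityAt_eq, hform, map_mul, map_prod, taylorAt, aeval_C, ← taylorAt]
    have hcoe : ((algebraMap ℂ (MvPolynomial (Fin 3) ℂ) a * ∏ s ∈ S, taylorAt q (Γ s).form :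
        MvPolynomial (Fin 3) ℂ) : MvPowerSeries (Fin 3) ℂ) =
        MvPowerSeries.C a * ∏ s ∈ S, ((taylorAt q (Γ s).form : MvPolynomial (Fin 3) ℂ) :
          MvPowerSeries (Fin 3) ℂ) := by
      rw [coe_mul, ← coeToMvPowerSeries.ringHom_apply (∏ s ∈ S, _), map_prod, algebraMap_eq, coe_C]
      rfl
    -- Over a domain the order of a product is the sum of the orders, and each factor contributes
    -- one.
    rw [hcoe, MvPowerSeries.order_mul, MvPowerSeries.order_prod]
    have h0 : (MvPowerSeries.C a : MvPowerSeries (Fin 3) ℂ).order = 0 := by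
      by_contra h
      rw [← ne_eq, MvPowerSeries.order_ne_zero_iff_constCoeff_eq_zero] at h
      exact ha (by simpa using h)
    rw [h0, zero_add, Finset.sum_congr rfl fun s hs => (multiplicityAt_eq (Γ s) q).symm.trans
      (hq s hs)]
    simp

/-! ### Base points of two kinds of pencils -/

theorem exists_rep_mk (w : Fin 3 → ℂ) (hw : w ≠ 0) :
    ∃ a : ℂ, a ≠ 0 ∧ ∀ l, (Projectivization.mk ℂ w hw).rep l = a * w l := by
  obtain ⟨a, ha⟩ := Projectivization.exists_smul_eq_mk_rep ℂ w hw
  exact ⟨a, a.ne_zero, fun l => by rw [← ha]; rfl⟩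

theorem eq_mk_of_rep (p : P2) (w : Fin 3 → ℂ) (hw : w ≠ 0) (a : ℂ) (h : ∀ l, p.rep l = a * w l) :
    p = Projectivization.mk ℂ w hw := by
  rw [← Projectivization.mk_rep p, Projectivization.mk_eq_mk_iff']
  exact ⟨a, funext fun l => (h l).symm⟩

theorem eq_of_rep {p q : P2} (a : ℂ) (h : ∀ l, p.rep l = a * q.rep l) : p = q := by
  rw [← Projectivization.mk_rep q]
  exact eq_mk_of_rep p _ _ a h

theorem eq_zero_of_three_roots {x y z a b c : ℂ} (hxy : x ≠ y) (hxz : x ≠ z) (hyz : y ≠ z)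
    (hx : a + x * b + x ^ 2 * c = 0) (hy : a + y * b + y ^ 2 * c = 0)
    (hz : a + z * b + z ^ 2 * c = 0) : a = 0 ∧ b = 0 ∧ c = 0 := by
  have h1 : b + (x + y) * c = 0 := mul_left_cancel₀ (sub_ne_zero.2 hxy) (by
    linear_combination hx - hy)
  have h2 : b + (x + z) * c = 0 := mul_left_cancel₀ (sub_ne_zero.2 hxz) (by
    linear_combination hx - hz)
  have hc : c = 0 := mul_left_cancel₀ (sub_ne_zero.2 hyz) (by linear_combination h1 - h2)
  subst hc
  have hb : b = 0 := by linear_combination h1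
  subst hb
  exact ⟨by linear_combination hx, rfl, rfl⟩

/-- Lines `a x + b y + μ c z = 0` with varying `μ` form a pencil with one base point. -/
theorem line_pencil {i j k : Fin 3} (hij : i ≠ j) (hik : i ≠ k) (hjk : j ≠ k) (S : Finset P2)
    (hS : 1 < S.card) (μ : P2 → ℂ) (hμ : Set.InjOn μ S) (T : P2 → PlaneCurve 1) (κ : P2 → ℂ)
    (hκ : ∀ s ∈ S, κ s ≠ 0) (a b c : ℂ) (ha : a ≠ 0) (hb : b ≠ 0) (hc : c ≠ 0)
    (hT : ∀ s ∈ S, (T s).form = C (κ s) * (C a * X i + C b * X j + C (μ s * c) * X k)) :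
    ∃ q : P2, (⋂ s ∈ S, (T s).points) = {q} ∧ IsFoldPoint S.card (⋃ s ∈ S, (T s).points) q := by
  -- The base point is the intersection of `a x + b y = 0` with `z = 0`.
  set w : Fin 3 → ℂ := fun l => if l = i then b else if l = j then -a else 0 with hw
  have wi : w i = b := by simp [hw]
  have wj : w j = -a := by simp [hw, hij.symm]
  have wk : w k = 0 := by simp [hw, hik.symm, hjk.symm]
  have hw0 : w ≠ 0 := fun h => hb (by rw [← wi, h]; rfl)
  obtain ⟨e, he, hrep⟩ := exists_rep_mk w hw0
  set q : P2 := Projectivization.mk ℂ w hw0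
  have hmem : ∀ s ∈ S, ∀ p : P2, p ∈ (T s).points ↔
      a * p.rep i + b * p.rep j + μ s * c * p.rep k = 0 := by
    intro s hs p
    simp only [PlaneCurve.points, Set.mem_ofPred_eq, hT s hs, map_mul, map_add, eval_C, eval_X,
      mul_eq_zero, hκ s hs, false_or]
  have hqmem : ∀ s ∈ S, q ∈ (T s).points := by
    intro s hs
    rw [hmem s hs, hrep, hrep, hrep, wi, wj, wk]
    ring
  refine ⟨q, ?_, isFoldPoint_biUnion S T (fun s _ => (T s).irreducible_form_of_degree_one) ?_ q ?_⟩
  · ext p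
    simp only [Set.mem_iInter, Set.mem_singleton_iff]
    constructor
    · intro h
      obtain ⟨s, hs, t, ht, hst⟩ := Finset.one_lt_card.1 hS
      have h1 := (hmem s hs p).1 (h s hs)
      have h2 := (hmem t ht p).1 (h t ht)
      have hk : p.rep k = 0 := by
        refine mul_left_cancel₀ (mul_ne_zero (sub_ne_zero.2 (hμ.ne hs ht hst)) hc) ?_
        linear_combination h1 - h2
      refine eq_mk_of_rep p w hw0 (p.rep i / b) (forall_of_ne hij hik hjk ?_ ?_ ?_)
      · rw [wi]; field_simp
      · rw [wj]; field_simp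
        rw [hk] at h1
        linear_combination h1
      · rw [wk, hk, mul_zero]
    · rintro rfl s hs
      exact hqmem s hs
  · intro s hs t ht hst
    have h1 := (hT s hs).symm.trans ((congrArg PlaneCurve.form hst).trans (hT t ht))
    have e1 := congrArg (eval (fun l => if l = i then (1 : ℂ) else 0)) h1
    have e2 := congrArg (eval (fun l => if l = k then (1 : ℂ) else 0)) h1
    simp [hij.symm, hik.symm] at e1
    simp [hik, hjk] at e2
    have e3 : κ s = κ t := e1.resolve_right ha
    rw [e3] at e2
    refine hμ hs ht ?_
    simpa [hκ t ht, hc] using e2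
  · intro s hs
    have hev : eval q.rep (T s).form = 0 := hqmem s hs
    -- The chart at `q` cannot be `k`, as `q_k = 0`. In either remaining chart the partial
    -- derivative in the other of `x_i`, `x_j` is a nonzero multiple of `a` or `b`.
    have hch : chart q = i ∨ chart q = j := by
      have := chart_spec q
      revert this
      refine forall_of_ne (P := fun l => q.rep l ≠ 0 → l = i ∨ l = j) hij hik hjk
        (fun _ => Or.inl rfl) (fun _ => Or.inr rfl) (fun h => absurd ?_ h) (chart q)
      rw [hrep, wk, mul_zero]
    rcases hch with h | h
    · refine multiplicityAt_eq_one _ q hev j (by rw [h]; exact hij.symm) ?_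
      rw [hT s hs]
      simp [pderiv_X, hij, hjk.symm, hκ s hs, hb]
    · refine multiplicityAt_eq_one _ q hev i (by rw [h]; exact hij) ?_
      rw [hT s hs]
      simp [pderiv_X, hij.symm, hik.symm, hκ s hs, ha]

/-- Conics `q(x, y) + μ l(x, y) z + μ² c z² = 0` with varying `μ` have two common points. -/
theorem conic_pencil {i j k : Fin 3} (hij : i ≠ j) (hik : i ≠ k) (hjk : j ≠ k) (S : Finset P2)
    (hS : 2 < S.card) (μ : P2 → ℂ) (hμ : Set.InjOn μ S) (O : P2 → PlaneCurve 2) (κ : P2 → ℂ)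
    (hκ : ∀ s ∈ S, κ s ≠ 0) (q0 q1 q2 l0 l1 c : ℂ) (hq0 : q0 ≠ 0) (hq2 : q2 ≠ 0)
    (hdisc : q1 ^ 2 - 4 * q0 * q2 ≠ 0) (hl0 : l0 ≠ 0) (hc : c ≠ 0)
    (hirr : ∀ s ∈ S, Irreducible (O s).form)
    (hO : ∀ s ∈ S, (O s).form = C (κ s) * (C q0 * X i ^ 2 + C q1 * (X i * X j) + C q2 * X j ^ 2 +
      C (μ s * l0) * (X i * X k) + C (μ s * l1) * (X j * X k) + C (μ s ^ 2 * c) * X k ^ 2)) :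
    ∃ p₁ p₂ : P2, p₁ ≠ p₂ ∧ (⋂ s ∈ S, (O s).points) = {p₁, p₂} ∧
      IsFoldPoint S.card (⋃ s ∈ S, (O s).points) p₁ ∧
      IsFoldPoint S.card (⋃ s ∈ S, (O s).points) p₂ := by
  obtain ⟨δ, hδ⟩ := IsAlgClosed.exists_pow_nat_eq (q1 ^ 2 - 4 * q0 * q2) (n := 2) (by norm_num)
  have hδ0 : δ ≠ 0 := by
    rintro rfl
    apply hdisc
    rw [← hδ]
    norm_num
  set w : ℂ → Fin 3 → ℂ := fun x l => if l = i then x else if l = j then 1 else 0 with hw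
  have wi : ∀ x, w x i = x := fun x => by simp [hw]
  have wj : ∀ x, w x j = 1 := fun x => by simp [hw, hij.symm]
  have wk : ∀ x, w x k = 0 := fun x => by simp [hw, hik.symm, hjk.symm]
  have hw0 : ∀ x, w x ≠ 0 := fun x h => one_ne_zero (by rw [← wj x, h]; rfl)
  set P : ℂ → P2 := fun x => Projectivization.mk ℂ (w x) (hw0 x) with hP
  have hmem : ∀ s ∈ S, ∀ p : P2, p ∈ (O s).points ↔
      (q0 * p.rep i ^ 2 + q1 * (p.rep i * p.rep j) + q2 * p.rep j ^ 2) +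
      μ s * (l0 * (p.rep i * p.rep k) + l1 * (p.rep j * p.rep k)) +
      μ s ^ 2 * (c * p.rep k ^ 2) = 0 := by
    intro s hs p
    simp only [PlaneCurve.points, Set.mem_ofPred_eq, hO s hs, map_mul, map_add, eval_C, eval_X,
      map_pow, mul_eq_zero, hκ s hs, false_or]
    rw [iff_iff_eq]
    congr 1
    ring
  have hroot : ∀ x, q0 * x ^ 2 + q1 * x + q2 = 0 → ∀ s ∈ S, P x ∈ (O s).points := by
    intro x hx s hs
    obtain ⟨e, he, hrep⟩ := exists_rep_mk (w x) (hw0 x)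
    rw [hmem s hs, hrep, hrep, hrep, wi, wj, wk]
    linear_combination e ^ 2 * hx
  have hinj : Set.InjOn O S := by
    intro s hs t ht hst
    have h1 := (hO s hs).symm.trans ((congrArg PlaneCurve.form hst).trans (hO t ht))
    -- The value at `e_i` recovers `κ`, and the difference of the values at `e_i + e_k` and `e_i -
    -- e_k` isolates `μ * l0`. The coefficient of `X k ^ 2` would only determine `μ ^ 2`.
    have e1 := congrArg (eval (fun l => if l = i then (1 : ℂ) else 0)) h1
    have e2 := congrArg (eval (fun l => if l = i then (1 : ℂ) else if l = k then 1 else 0)) h1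
    have e3 := congrArg (eval (fun l => if l = i then (1 : ℂ) else if l = k then -1 else 0)) h1
    simp [hij.symm, hik.symm] at e1
    simp [hik.symm, hij.symm, hjk] at e2 e3
    have e4 : κ s = κ t := e1.resolve_right hq0
    rw [e4] at e2 e3
    refine hμ hs ht (mul_left_cancel₀ (mul_ne_zero (hκ t ht) hl0) ?_)
    linear_combination (e2 - e3) / 2
  have hfold : ∀ x, q0 * x ^ 2 + q1 * x + q2 = 0 → 2 * q0 * x + q1 ≠ 0 →
      IsFoldPoint S.card (⋃ s ∈ S, (O s).points) (P x) := by
    intro x hx hx'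
    have hx0 : x ≠ 0 := by
      rintro rfl
      exact hq2 (by linear_combination hx)
    -- At a zero of `q` the Euler relation links its two partial derivatives, and `x ≠ 0` because
    -- `q2 ≠ 0`. A simple zero therefore gives smoothness in either possible chart.
    have hx'' : q1 * x + 2 * q2 ≠ 0 := by
      intro h
      refine mul_ne_zero hx0 hx' ?_
      linear_combination 2 * hx - h
    refine isFoldPoint_biUnion S O hirr hinj _ fun s hs => ?_
    have hev : eval (P x).rep (O s).form = 0 := hroot x hx s hs
    obtain ⟨e, he, hrep⟩ := exists_rep_mk (w x) (hw0 x)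
    have hch : chart (P x) = i ∨ chart (P x) = j := by
      have := chart_spec (P x)
      revert this
      refine forall_of_ne (P := fun l => (P x).rep l ≠ 0 → l = i ∨ l = j) hij hik hjk
        (fun _ => Or.inl rfl) (fun _ => Or.inr rfl) (fun h => absurd ?_ h) (chart (P x))
      rw [hrep, wk, mul_zero]
    rcases hch with h | h
    · refine multiplicityAt_eq_one _ _ hev j (by rw [h]; exact hij.symm) ?_
      rw [hO s hs]
      have : eval (P x).rep (pderiv j (C (κ s) * (C q0 * X i ^ 2 + C q1 * (X i * X j) +
          C q2 * X j ^ 2 + C (μ s * l0) * (X i * X k) + C (μ s * l1) * (X j * X k) +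
          C (μ s ^ 2 * c) * X k ^ 2))) = κ s * e * (q1 * x + 2 * q2) := by
        simp only [map_add, Derivation.leibniz, Derivation.leibniz_pow, pderiv_C, pderiv_X,
          Pi.single_eq_same, Pi.single_eq_of_ne hij, Pi.single_eq_of_ne hjk.symm, smul_eq_mul,
          map_mul, map_pow, eval_X, eval_C, hP, hrep, wi, wj, wk, map_one, map_zero,
          nsmul_eq_mul]
        simp
        ring
      rw [this]
      exact mul_ne_zero (mul_ne_zero (hκ s hs) he) hx''
    · refine multiplicityAt_eq_one _ _ hev i (by rw [h]; exact hij) ?_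
      rw [hO s hs]
      have : eval (P x).rep (pderiv i (C (κ s) * (C q0 * X i ^ 2 + C q1 * (X i * X j) +
          C q2 * X j ^ 2 + C (μ s * l0) * (X i * X k) + C (μ s * l1) * (X j * X k) +
          C (μ s ^ 2 * c) * X k ^ 2))) = κ s * e * (2 * q0 * x + q1) := by
        simp only [map_add, Derivation.leibniz, Derivation.leibniz_pow, pderiv_C, pderiv_X,
          Pi.single_eq_same, Pi.single_eq_of_ne hij.symm, Pi.single_eq_of_ne hik.symm, smul_eq_mul,
          map_mul, map_pow, eval_X, eval_C, hP, hrep, wi, wj, wk, map_one, map_zero,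
          nsmul_eq_mul]
        simp
        ring
      rw [this]
      exact mul_ne_zero (mul_ne_zero (hκ s hs) he) hx'
  have hfac : ∀ x, q0 * x ^ 2 + q1 * x + q2 = q0 * (x - (-q1 + δ) / (2 * q0)) *
      (x - (-q1 - δ) / (2 * q0)) := by
    intro x
    field_simp
    linear_combination hδ
  set x1 := (-q1 + δ) / (2 * q0) with hx1
  set x2 := (-q1 - δ) / (2 * q0) with hx2
  have hr1 : q0 * x1 ^ 2 + q1 * x1 + q2 = 0 := by rw [hfac]; ring
  have hr2 : q0 * x2 ^ 2 + q1 * x2 + q2 = 0 := by rw [hfac]; ring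
  have hs1 : 2 * q0 * x1 + q1 = δ := by rw [hx1]; field_simp; ring
  have hs2 : 2 * q0 * x2 + q1 = -δ := by rw [hx2]; field_simp; ring
  refine ⟨P x1, P x2, ?_, ?_, hfold x1 hr1 (by rw [hs1]; exact hδ0),
    hfold x2 hr2 (by rw [hs2]; exact neg_ne_zero.2 hδ0)⟩
  · intro h
    rw [hP, Projectivization.mk_eq_mk_iff'] at h
    obtain ⟨a, ha⟩ := h
    have ha1 := congrFun ha j
    have ha2 := congrFun ha i
    rw [Pi.smul_apply, wj, wj, smul_eq_mul, mul_one] at ha1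
    rw [Pi.smul_apply, wi, wi, smul_eq_mul, ha1, one_mul] at ha2
    rw [ha2] at hs2
    have : (2 : ℂ) * δ = 0 := by linear_combination hs2 - hs1
    exact hδ0 (by simpa using this)
  · ext p
    simp only [Set.mem_iInter, Set.mem_insert_iff, Set.mem_singleton_iff]
    constructor
    · intro h
      obtain ⟨s, hs, t, ht, u, hu, hst, hsu, htu⟩ := Finset.two_lt_card.1 hS
      -- For a fixed common point the equation is a polynomial of degree at most two in `μ` with
      -- three roots. Its leading coefficient gives `z = 0` and its constant term gives `q(x, y) =
      -- 0`.
      obtain ⟨e1, -, e3⟩ := eq_zero_of_three_roots (hμ.ne hs ht hst) (hμ.ne hs hu hsu)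
        (hμ.ne ht hu htu) ((hmem s hs p).1 (h s hs)) ((hmem t ht p).1 (h t ht))
        ((hmem u hu p).1 (h u hu))
      have hk : p.rep k = 0 := by simpa [hc] using e3
      have hj : p.rep j ≠ 0 := by
        intro hj
        rw [hj] at e1
        have hi : p.rep i = 0 := by simpa [hq0] using e1
        exact p.rep_nonzero (funext (forall_of_ne hij hik hjk hi hj hk))
      have hx : q0 * (p.rep i / p.rep j) ^ 2 + q1 * (p.rep i / p.rep j) + q2 = 0 := by
        field_simp
        linear_combination e1
      have hpx : ∀ x, p.rep i / p.rep j = x → p = P x := by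
        intro x hx
        refine eq_mk_of_rep p (w x) (hw0 x) (p.rep j) (forall_of_ne hij hik hjk ?_ ?_ ?_)
        · rw [wi, ← hx]; field_simp
        · rw [wj, mul_one]
        · rw [wk, hk, mul_zero]
      rw [hfac, mul_assoc] at hx
      rcases mul_eq_zero.1 ((mul_eq_zero.1 hx).resolve_left hq0) with h1 | h1
      · exact Or.inl (hpx _ (sub_eq_zero.1 h1))
      · exact Or.inr (hpx _ (sub_eq_zero.1 h1))
    · rintro (rfl | rfl) s hs
      · exact hroot _ hr1 s hs
      · exact hroot _ hr2 s hs

/-! ### Tangents and conics at sextactic points on a line through a vertex -/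

theorem eval_sextacticForm (d : ℕ) (v x : Fin 3 → ℂ) (i j k : Fin 3) :
    eval x (sextacticForm d v i j k) =
      d * (d + 1) * ((x i * (v i)⁻¹) ^ 2 + (x j * (v j)⁻¹) ^ 2) -
      4 * (d + 1) * (2 * d - 3) * (x k * (v k)⁻¹) ^ 2 +
      8 * d * (d - 2) * ((x j * (v j)⁻¹) * (x k * (v k)⁻¹) + (x i * (v i)⁻¹) * (x k * (v k)⁻¹)) -
      2 * (d - 2) * (5 * d - 3) * ((x i * (v i)⁻¹) * (x j * (v j)⁻¹)) := by
  simp only [sextacticForm, map_add, map_mul, map_pow, eval_X, eval_C]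
  ring

theorem natCast_sub_ne_zero {d : ℕ} (hd : 3 < d) : (d : ℂ) ≠ 0 ∧ (d : ℂ) + 1 ≠ 0 ∧
    (d : ℂ) - 1 ≠ 0 ∧ (d : ℂ) - 2 ≠ 0 ∧ (d : ℂ) - 3 ≠ 0 ∧ 2 * (d : ℂ) - 3 ≠ 0 ∧
    2 * (d : ℂ) - 1 ≠ 0 ∧ 5 * (d : ℂ) - 3 ≠ 0 := by
  have hz : ∀ z : ℤ, z ≠ 0 → ((z : ℤ) : ℂ) ≠ 0 := fun z hz => Int.cast_ne_zero.2 hz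
  have h (z : ℤ) (w : ℂ) (hzw : (z : ℂ) = w) (h0 : z ≠ 0) : w ≠ 0 := hzw ▸ hz z h0
  refine ⟨h d _ (by push_cast; ring) (by omega), h (d + 1) _ (by push_cast; ring) (by omega),
    h (d - 1) _ (by push_cast; ring) (by omega), h (d - 2) _ (by push_cast; ring) (by omega),
    h (d - 3) _ (by push_cast; ring) (by omega), h (2 * d - 3) _ (by push_cast; ring) (by omega),
    h (2 * d - 1) _ (by push_cast; ring) (by omega),
    h (5 * d - 3) _ (by push_cast; ring) (by omega)⟩

/-- A period lies in the kernel of the Gram matrix, which is nondegenerate in the coordinates `x_l /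
v_l`. By the symmetry in the first two coordinates it splits into the factor `12 (d - 1)²` on
antisymmetric vectors and a block on symmetric ones of determinant `±9 (d - 1)²` after scaling of
the rows. -/
theorem irreducible_of_form_eq_sextacticForm {d : ℕ} (hd : 3 < d) (O : PlaneCurve 2)
    (v : Fin 3 → ℂ) (hv : ∀ l, v l ≠ 0) {i j k : Fin 3} (hij : i ≠ j) (hik : i ≠ k) (hjk : j ≠ k)
    (κ : ℂ) (hκ : κ ≠ 0) (hO : O.form = C κ * sextacticForm d v i j k) : Irreducible O.form := by
  refine irreducible_of_forall_period O.isHomogeneous_form O.form_ne_zero fun w hw => ?_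
  have hQ : ∀ x : Fin 3 → ℂ, eval (x + w) (sextacticForm d v i j k) =
      eval x (sextacticForm d v i j k) := by
    intro x
    have := hw x
    rw [hO, map_mul, map_mul, eval_C, eval_C] at this
    exact mul_left_cancel₀ hκ this
  set y1 := w i * (v i)⁻¹ with hy1
  set y2 := w j * (v j)⁻¹ with hy2
  set y3 := w k * (v k)⁻¹ with hy3
  have hQ' : ∀ a b c : ℂ,
      d * (d + 1) * ((a + y1) ^ 2 + (b + y2) ^ 2) -
      4 * (d + 1) * (2 * d - 3) * (c + y3) ^ 2 +
      8 * d * (d - 2) * ((b + y2) * (c + y3) + (a + y1) * (c + y3)) -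
      2 * (d - 2) * (5 * d - 3) * ((a + y1) * (b + y2)) =
      d * (d + 1) * (a ^ 2 + b ^ 2) -
      4 * (d + 1) * (2 * d - 3) * c ^ 2 + 8 * d * (d - 2) * (b * c + a * c) -
      2 * (d - 2) * (5 * d - 3) * (a * b) := by
    intro a b c
    have := hQ (fun l => if l = i then a * v i else if l = j then b * v j else c * v k)
    rw [eval_sextacticForm, eval_sextacticForm] at this
    have hvi := hv i
    have hvj := hv j
    have hvk := hv k
    simp only [Pi.add_apply, if_true, if_neg hij.symm, if_neg hik.symm, if_neg hjk.symm, add_mul,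
      mul_inv_cancel_right₀ hvi, mul_inv_cancel_right₀ hvj, mul_inv_cancel_right₀ hvk] at this
    linear_combination this
  obtain ⟨n0, n1, n2, n3, n4, n5, n6, n7⟩ := natCast_sub_ne_zero hd
  have h0 := hQ' 0 0 0
  have h1 := hQ' 1 0 0
  have h2 := hQ' 0 1 0
  have h3 := hQ' 0 0 1
  have e12 : y1 = y2 := by
    have : (12 : ℂ) * (d - 1) ^ 2 ≠ 0 := mul_ne_zero (by norm_num) (pow_ne_zero _ n2)
    refine mul_left_cancel₀ this ?_
    linear_combination h1 - h2
  rw [e12] at h0 h1 h2 h3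
  have e3 : -((2 * d - 1) * (d - 3)) * y2 + 2 * d * (d - 2) * y3 = 0 := by
    linear_combination (h1 - h0) / 4
  have e4 : 2 * d * (d - 2) * y2 - (d + 1) * (2 * d - 3) * y3 = 0 := by
    linear_combination (h3 - h0) / 8
  have hy2 : y2 = 0 := by
    have : (9 : ℂ) * (d - 1) ^ 2 ≠ 0 := mul_ne_zero (by norm_num) (pow_ne_zero _ n2)
    refine (mul_eq_zero.1 (?_ : (9 : ℂ) * (d - 1) ^ 2 * y2 = 0)).resolve_left this
    linear_combination (d + 1) * (2 * d - 3) * e3 + 2 * d * (d - 2) * e4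
  have hy3 : y3 = 0 := by
    rw [hy2] at e4
    have := mul_ne_zero n1 n5
    refine (mul_eq_zero.1 (?_ : ((d : ℂ) + 1) * (2 * d - 3) * y3 = 0)).resolve_left this
    linear_combination -e4
  have hz : ∀ l, w l * (v l)⁻¹ = 0 → w l = 0 := fun l h =>
    (mul_eq_zero.1 h).resolve_right (inv_ne_zero (hv l))
  exact funext (forall_of_ne hij hik hjk (hz i (e12.trans hy2)) (hz j hy2) (hz k hy3))

/-- On the line `y = t x` the ratio `x / z` determines the point. It is the parameter `μ` of both
pencils. -/
theorem injOn_div_rep {i j k : Fin 3} (hij : i ≠ j) (hik : i ≠ k) (hjk : j ≠ k) (S : Finset P2)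
    (hv : ∀ s ∈ S, ∀ l, s.rep l ≠ 0) (t : ℂ) (ht : ∀ s ∈ S, s.rep j = t * s.rep i) :
    Set.InjOn (fun s : P2 => s.rep i / s.rep k) S := by
  intro s hs s' hs' h
  have h1 := hv s hs
  have h2 := hv s' hs'
  refine eq_of_rep (s.rep i / s'.rep i) (forall_of_ne hij hik hjk ?_ ?_ ?_)
  · rw [div_mul_cancel₀ _ (h2 i)]
  · rw [ht s hs, ht s' hs']
    have := h2 i
    field_simp
  · have a1 := h1 k
    have a2 := h2 k
    have a3 := h2 i
    simp only at h
    field_simp at h ⊢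
    linear_combination -h

/-- The conclusion about tangent lines, for points on a line `y = t x`. -/
theorem tangent_conclusion {d : ℕ} (hd : 3 < d) {i j k : Fin 3} (hij : i ≠ j) (hik : i ≠ k)
    (hjk : j ≠ k) (S : Finset P2) (hS : 2 < S.card)
    (hsext : ∀ s ∈ S, IsSextacticPoint (fermatCurve d) s) (t : ℂ)
    (ht : ∀ s ∈ S, s.rep j = t * s.rep i) (T : P2 → PlaneCurve 1)
    (hT : ∀ s ∈ S, IsTangentLine (fermatCurve d) s (T s)) :
    ∃ q : P2, (⋂ s ∈ S, (T s).points) = {q} ∧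
      IsFoldPoint S.card (⋃ s ∈ S, (T s).points) q := by
  have hv : ∀ s ∈ S, ∀ l, s.rep l ≠ 0 := fun s hs => (hsext s hs).rep_ne_zero hd
  obtain ⟨s₀, hs₀⟩ := Finset.card_pos.1 (by omega : 0 < S.card)
  have ht0 : t ≠ 0 := fun h => hv s₀ hs₀ j (by rw [ht s₀ hs₀, h, zero_mul])
  have hk : ∀ s ∈ S, s.rep k ^ d = -(1 + t ^ d) * s.rep i ^ d := by
    intro s hs
    have := (hsext s hs).sum_rep_pow
    rw [sum_eq_of_ne hij hik hjk, ht s hs, mul_pow] at this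
    linear_combination this
  have hc : -(1 + t ^ d) ≠ 0 := fun h => pow_ne_zero d (hv s₀ hs₀ k) (by
    rw [hk s₀ hs₀, h, zero_mul])
  have hform : ∀ s : P2, ∃ κ : ℂ, s ∈ S → κ ≠ 0 ∧ (T s).form =
      C κ * ∑ l, C (s.rep l ^ d * (s.rep l)⁻¹) * X l := by
    intro s
    by_cases hs : s ∈ S
    · obtain ⟨κ, hκ⟩ := (isTangentLine_iff (by omega) (T s) s (hsext s hs).sum_rep_pow (hv s hs)).1
        (hT s hs)
      refine ⟨κ, fun _ => ⟨fun h0 => (T s).form_ne_zero ?_, hκ⟩⟩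
      rw [hκ, h0, C_0, zero_mul]
    · exact ⟨0, fun h => absurd h hs⟩
  choose κ hκ using hform
  -- After division by `s_i ^ (d - 1)`, the tangent coefficients are `1`, `t ^ (d - 1)` and `-(1 + t
  -- ^ d) * s_i / s_k`, so only the last one depends on the point.
  refine line_pencil hij hik hjk S (by omega) (fun s => s.rep i / s.rep k)
    (injOn_div_rep hij hik hjk S hv t ht) T
    (fun s => κ s * (s.rep i ^ d * (s.rep i)⁻¹)) (fun s hs => ?_) 1 (t ^ d * t⁻¹) (-(1 + t ^ d))
    one_ne_zero (mul_ne_zero (pow_ne_zero _ ht0) (inv_ne_zero ht0)) hc fun s hs => ?_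
  · exact mul_ne_zero (hκ s hs).1 (mul_ne_zero (pow_ne_zero _ (hv s hs i)) (inv_ne_zero (hv s hs i)))
  · have h1 := hv s hs i
    have h3 := hv s hs k
    have e2 : s.rep j ^ d * (s.rep j)⁻¹ = s.rep i ^ d * (s.rep i)⁻¹ * (t ^ d * t⁻¹) := by
      rw [ht s hs, mul_pow, mul_inv]
      ring
    have e3 : s.rep k ^ d * (s.rep k)⁻¹ =
        s.rep i ^ d * (s.rep i)⁻¹ * (s.rep i / s.rep k * -(1 + t ^ d)) := by
      rw [hk s hs]
      field_simp
    rw [(hκ s hs).2, sum_eq_of_ne hij hik hjk, e2, e3]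
    simp only [C_mul, C_1]
    ring

theorem exists_sextacticForm {d : ℕ} (hd : 3 < d) {i j k : Fin 3} (hij : i ≠ j) (hik : i ≠ k)
    (hjk : j ≠ k) (S : Finset P2)
    (hsext : ∀ s ∈ S, IsSextacticPoint (fermatCurve d) s)
    (hpow : ∀ s ∈ S, s.rep i ^ d = s.rep j ^ d) (O : P2 → PlaneCurve 2)
    (hO : ∀ s ∈ S, IsHyperosculatingConic (fermatCurve d) s (O s)) :
    ∃ κ : P2 → ℂ, ∀ s ∈ S, κ s ≠ 0 ∧ (O s).form = C (κ s) * sextacticForm d s.rep i j k := by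
  have hform : ∀ s : P2, ∃ κ : ℂ, s ∈ S → κ ≠ 0 ∧ (O s).form =
      C κ * sextacticForm d s.rep i j k := by
    intro s
    by_cases hs : s ∈ S
    · obtain ⟨κ, hκ⟩ := exists_form_eq_sextacticForm hd (O s) s (hsext s hs).sum_rep_pow
        ((hsext s hs).rep_ne_zero hd) (hO s hs) hij hik hjk (hpow s hs)
      exact ⟨κ, fun _ => hκ⟩
    · exact ⟨0, fun h => absurd h hs⟩
  choose κ hκ using hform
  exact ⟨κ, hκ⟩

/-- The conclusion about conics, for points with `x ^ d = y ^ d` on a line `y = t x`. -/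
theorem conic_conclusion_of_pow_eq {d : ℕ} (hd : 3 < d) {i j k : Fin 3} (hij : i ≠ j) (hik : i ≠ k)
    (hjk : j ≠ k) (S : Finset P2) (hS : 2 < S.card)
    (hsext : ∀ s ∈ S, IsSextacticPoint (fermatCurve d) s) (t : ℂ)
    (ht : ∀ s ∈ S, s.rep j = t * s.rep i) (hpow : ∀ s ∈ S, s.rep i ^ d = s.rep j ^ d)
    (O : P2 → PlaneCurve 2) (hO : ∀ s ∈ S, IsHyperosculatingConic (fermatCurve d) s (O s)) :
    ∃ p₁ p₂ : P2, p₁ ≠ p₂ ∧ (⋂ s ∈ S, (O s).points) = {p₁, p₂} ∧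
      IsFoldPoint S.card (⋃ s ∈ S, (O s).points) p₁ ∧
      IsFoldPoint S.card (⋃ s ∈ S, (O s).points) p₂ := by
  have hv : ∀ s ∈ S, ∀ l, s.rep l ≠ 0 := fun s hs => (hsext s hs).rep_ne_zero hd
  obtain ⟨s₀, hs₀⟩ := Finset.card_pos.1 (by omega : 0 < S.card)
  have ht0 : t ≠ 0 := fun h => hv s₀ hs₀ j (by rw [ht s₀ hs₀, h, zero_mul])
  obtain ⟨κ, hκ⟩ := exists_sextacticForm hd hij hik hjk S hsext hpow O hO
  obtain ⟨n0, n1, n2, n3, n4, n5, n6, n7⟩ := natCast_sub_ne_zero hd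
  -- The discriminant has the factor `d - 3`: for the excluded cubic the two base points would
  -- coincide.
  have hdisc : (-2 * (d - 2) * (5 * d - 3) * t⁻¹) ^ 2 -
      4 * (d * (d + 1) : ℂ) * (d * (d + 1) * t⁻¹ ^ 2) ≠ 0 := by
    have : (-2 * (d - 2) * (5 * d - 3) * t⁻¹) ^ 2 -
      4 * (d * (d + 1) : ℂ) * (d * (d + 1) * t⁻¹ ^ 2) =
      48 * (2 * d - 1) * (d - 3) * (d - 1) ^ 2 * t⁻¹ ^ 2 := by ring
    rw [this]
    exact mul_ne_zero (mul_ne_zero (mul_ne_zero (mul_ne_zero (by norm_num) n6) n4)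
      (pow_ne_zero _ n2)) (pow_ne_zero _ (inv_ne_zero ht0))
  refine conic_pencil hij hik hjk S hS (fun s => s.rep i / s.rep k)
    (injOn_div_rep hij hik hjk S hv t ht) O (fun s => κ s * (s.rep i)⁻¹ ^ 2)
    (fun s hs => mul_ne_zero (hκ s hs).1 (pow_ne_zero _ (inv_ne_zero (hv s hs i))))
    (d * (d + 1)) (-2 * (d - 2) * (5 * d - 3) * t⁻¹) (d * (d + 1) * t⁻¹ ^ 2)
    (8 * d * (d - 2)) (8 * d * (d - 2) * t⁻¹) (-4 * (d + 1) * (2 * d - 3))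
    (mul_ne_zero n0 n1) (mul_ne_zero (mul_ne_zero n0 n1) (pow_ne_zero _ (inv_ne_zero ht0))) hdisc
    (mul_ne_zero (mul_ne_zero (by norm_num) n0) n3)
    (mul_ne_zero (mul_ne_zero (by norm_num) n1) n5)
    (fun s hs => irreducible_of_form_eq_sextacticForm hd (O s) s.rep (hv s hs) hij hik hjk (κ s)
      (hκ s hs).1 (hκ s hs).2) fun s hs => ?_
  have hu : s.rep i / s.rep k * (s.rep i)⁻¹ = (s.rep k)⁻¹ := by
    have h1 := hv s hs i
    field_simp
  rw [(hκ s hs).2, sextacticForm, ht s hs, mul_inv, ← hu]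
  simp only [C_mul, C_pow]
  ring

/-- The conclusion about conics, for points with `x ^ d = z ^ d` on a line `y = t x`. -/
theorem conic_conclusion_of_pow_eq' {d : ℕ} (hd : 3 < d) {i j k : Fin 3} (hij : i ≠ j)
    (hik : i ≠ k) (hjk : j ≠ k) (S : Finset P2) (hS : 2 < S.card)
    (hsext : ∀ s ∈ S, IsSextacticPoint (fermatCurve d) s) (t : ℂ)
    (ht : ∀ s ∈ S, s.rep j = t * s.rep i) (hpow : ∀ s ∈ S, s.rep i ^ d = s.rep k ^ d)
    (O : P2 → PlaneCurve 2) (hO : ∀ s ∈ S, IsHyperosculatingConic (fermatCurve d) s (O s)) :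
    ∃ p₁ p₂ : P2, p₁ ≠ p₂ ∧ (⋂ s ∈ S, (O s).points) = {p₁, p₂} ∧
      IsFoldPoint S.card (⋃ s ∈ S, (O s).points) p₁ ∧
      IsFoldPoint S.card (⋃ s ∈ S, (O s).points) p₂ := by
  have hv : ∀ s ∈ S, ∀ l, s.rep l ≠ 0 := fun s hs => (hsext s hs).rep_ne_zero hd
  obtain ⟨s₀, hs₀⟩ := Finset.card_pos.1 (by omega : 0 < S.card)
  have ht0 : t ≠ 0 := fun h => hv s₀ hs₀ j (by rw [ht s₀ hs₀, h, zero_mul])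
  -- The exceptional coordinate is now `j`, so the roles of `j` and `k` in the conic are exchanged.
  -- The binary form in `x_i`, `x_j` changes accordingly, and its discriminant has no factor `d -
  -- 3`.
  obtain ⟨κ, hκ⟩ := exists_sextacticForm hd hik hij hjk.symm S hsext hpow O hO
  obtain ⟨n0, n1, n2, n3, n4, n5, n6, n7⟩ := natCast_sub_ne_zero hd
  have hdisc : (8 * d * (d - 2) * t⁻¹) ^ 2 -
      4 * (d * (d + 1) : ℂ) * (-4 * (d + 1) * (2 * d - 3) * t⁻¹ ^ 2) ≠ 0 := by
    have : (8 * d * (d - 2) * t⁻¹) ^ 2 -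
      4 * (d * (d + 1) : ℂ) * (-4 * (d + 1) * (2 * d - 3) * t⁻¹ ^ 2) =
      48 * d * (2 * d - 1) * (d - 1) ^ 2 * t⁻¹ ^ 2 := by ring
    rw [this]
    exact mul_ne_zero (mul_ne_zero (mul_ne_zero (mul_ne_zero (by norm_num) n0) n6)
      (pow_ne_zero _ n2)) (pow_ne_zero _ (inv_ne_zero ht0))
  refine conic_pencil hij hik hjk S hS (fun s => s.rep i / s.rep k)
    (injOn_div_rep hij hik hjk S hv t ht) O (fun s => κ s * (s.rep i)⁻¹ ^ 2)
    (fun s hs => mul_ne_zero (hκ s hs).1 (pow_ne_zero _ (inv_ne_zero (hv s hs i))))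
    (d * (d + 1)) (8 * d * (d - 2) * t⁻¹) (-4 * (d + 1) * (2 * d - 3) * t⁻¹ ^ 2)
    (-2 * (d - 2) * (5 * d - 3)) (8 * d * (d - 2) * t⁻¹) (d * (d + 1))
    (mul_ne_zero n0 n1) (mul_ne_zero (mul_ne_zero (mul_ne_zero (by norm_num) n1) n5)
      (pow_ne_zero _ (inv_ne_zero ht0))) hdisc
    (mul_ne_zero (mul_ne_zero (by norm_num) n3) n7) (mul_ne_zero n0 n1)
    (fun s hs => irreducible_of_form_eq_sextacticForm hd (O s) s.rep (hv s hs) hik hij hjk.symm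
      (κ s) (hκ s hs).1 (hκ s hs).2) fun s hs => ?_
  have hu : s.rep i / s.rep k * (s.rep i)⁻¹ = (s.rep k)⁻¹ := by
    have h1 := hv s hs i
    field_simp
  rw [(hκ s hs).2, sextacticForm, ht s hs, mul_inv, ← hu]
  simp only [C_mul, C_pow]
  ring

/-- The conclusion about conics, for points on a line `y = t x`. -/
theorem conic_conclusion {d : ℕ} (hd : 3 < d) {i j k : Fin 3} (hij : i ≠ j) (hik : i ≠ k)
    (hjk : j ≠ k) (S : Finset P2) (hS : 2 < S.card)
    (hsext : ∀ s ∈ S, IsSextacticPoint (fermatCurve d) s) (t : ℂ)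
    (ht : ∀ s ∈ S, s.rep j = t * s.rep i)
    (O : P2 → PlaneCurve 2) (hO : ∀ s ∈ S, IsHyperosculatingConic (fermatCurve d) s (O s)) :
    ∃ p₁ p₂ : P2, p₁ ≠ p₂ ∧ (⋂ s ∈ S, (O s).points) = {p₁, p₂} ∧
      IsFoldPoint S.card (⋃ s ∈ S, (O s).points) p₁ ∧
      IsFoldPoint S.card (⋃ s ∈ S, (O s).points) p₂ := by
  have hv : ∀ s ∈ S, ∀ l, s.rep l ≠ 0 := fun s hs => (hsext s hs).rep_ne_zero hd
  obtain ⟨s₀, hs₀⟩ := Finset.card_pos.1 (by omega : 0 < S.card)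
  have ht0 : t ≠ 0 := fun h => hv s₀ hs₀ j (by rw [ht s₀ hs₀, h, zero_mul])
  have hk : ∀ s ∈ S, s.rep k ^ d = -(1 + t ^ d) * s.rep i ^ d := by
    intro s hs
    have := (hsext s hs).sum_rep_pow
    rw [sum_eq_of_ne hij hik hjk, ht s hs, mul_pow] at this
    linear_combination this
  have hj : ∀ s ∈ S, s.rep j ^ d = t ^ d * s.rep i ^ d := fun s hs => by rw [ht s hs, mul_pow]
  have hne : s₀.rep i ^ d ≠ 0 := pow_ne_zero _ (hv s₀ hs₀ i)
  -- On the line, `s_j ^ d` and `s_k ^ d` are fixed multiples of `s_i ^ d`, so a coincidence of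
  -- `d`-th powers at one point `s₀` holds at every point of `S`.
  have hcases : s₀.rep i ^ d = s₀.rep j ^ d ∨ s₀.rep i ^ d = s₀.rep k ^ d ∨
      s₀.rep j ^ d = s₀.rep k ^ d := by
    obtain ⟨l, hl⟩ := (hsext s₀ hs₀).exists_pow_eq hd
    have hpair : ∃ a b : Fin 3, a ≠ b ∧ s₀.rep a ^ d = s₀.rep b ^ d := by
      fin_cases l
      · exact ⟨1, 2, by decide, sub_eq_zero.1 hl⟩
      · exact ⟨2, 0, by decide, sub_eq_zero.1 hl⟩
      · exact ⟨0, 1, by decide, sub_eq_zero.1 hl⟩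
    obtain ⟨a, b, hab, h⟩ := hpair
    revert hab h
    refine forall_of_ne (P := fun a => a ≠ b → s₀.rep a ^ d = s₀.rep b ^ d → _) hij hik hjk
      ?_ ?_ ?_ a <;>
    refine forall_of_ne (P := fun b => _ ≠ b → s₀.rep _ ^ d = s₀.rep b ^ d → _) hij hik hjk
      ?_ ?_ ?_ b
    · exact fun h => absurd rfl h
    · exact fun _ h => Or.inl h
    · exact fun _ h => Or.inr (Or.inl h)
    · exact fun _ h => Or.inl h.symm
    · exact fun h => absurd rfl h
    · exact fun _ h => Or.inr (Or.inr h)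
    · exact fun _ h => Or.inr (Or.inl h.symm)
    · exact fun _ h => Or.inr (Or.inr h.symm)
    · exact fun h => absurd rfl h
  rcases hcases with h | h | h
  · refine conic_conclusion_of_pow_eq hd hij hik hjk S hS hsext t ht (fun s hs => ?_) O hO
    rw [hj s₀ hs₀] at h
    have : t ^ d = 1 := mul_right_cancel₀ hne (by rw [one_mul]; exact h.symm)
    rw [hj s hs, this, one_mul]
  · refine conic_conclusion_of_pow_eq' hd hij hik hjk S hS hsext t ht (fun s hs => ?_) O hO
    rw [hk s₀ hs₀] at h
    have : -(1 + t ^ d) = 1 := mul_right_cancel₀ hne (by rw [one_mul]; exact h.symm)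
    rw [hk s hs, this, one_mul]
  · refine conic_conclusion_of_pow_eq' hd hij.symm hjk hik S hS hsext t⁻¹ (fun s hs => ?_)
      (fun s hs => ?_) O hO
    · rw [ht s hs, inv_mul_cancel_left₀ ht0]
    · rw [hk s₀ hs₀, hj s₀ hs₀] at h
      have : t ^ d = -(1 + t ^ d) := mul_right_cancel₀ hne h
      rw [hk s hs, hj s hs, ← this]

/-! ### Lines that avoid the vertices of the coordinate triangle -/

/-- `v_k ^ d = -2 v_l ^ d` for both `l ≠ k`. -/
def HasType (d : ℕ) (v : Fin 3 → ℂ) (k : Fin 3) : Prop := ∀ l, l ≠ k → v k ^ d = -2 * v l ^ d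

theorem IsSextacticPoint.exists_hasType {d : ℕ} (hd : 3 < d) {s : P2}
    (h : IsSextacticPoint (fermatCurve d) s) : ∃ k, HasType d s.rep k := by
  obtain ⟨k, hk⟩ := h.exists_pow_eq hd
  have hs := h.sum_rep_pow
  rw [Fin.sum_univ_three] at hs
  refine ⟨k, fun l hl => ?_⟩
  fin_cases k <;> fin_cases l <;> first
    | exact absurd rfl hl
    | (simp only [standardWeight, Fin.isValue, Fin.mk_zero, Fin.mk_one, Fin.reduceFinMk,
        Matrix.cons_val] at hk ⊢
       first
        | linear_combination hs + hk
        | linear_combination hs - hk)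

theorem HasType.ratio {d : ℕ} {v : Fin 3 → ℂ} {i j k : Fin 3} (hik : i ≠ k) (hjk : j ≠ k)
    (h : HasType d v k) (hv : ∀ l, v l ≠ 0) :
    (v j / v i) ^ d = 1 ∧ (v k / v i) ^ d = -2 := by
  have h1 := h i hik
  have h2 := h j hjk
  have h0 := pow_ne_zero d (hv i)
  rw [div_pow, div_pow]
  constructor
  · rw [div_eq_one_iff_eq h0]
    linear_combination (h2 - h1) / 2
  · rw [div_eq_iff h0, h1]

theorem normSq_eq_one_of_pow {d : ℕ} (hd : d ≠ 0) {z : ℂ} (h : z ^ d = 1) : Complex.normSq z = 1 := by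
  have := congrArg Complex.normSq h
  rw [map_pow, map_one] at this
  exact (pow_eq_one_iff_of_nonneg (Complex.normSq_nonneg z) hd).1 this

theorem normSq_pow_of_pow {d : ℕ} {z : ℂ} (h : z ^ d = -2) : Complex.normSq z ^ d = 4 := by
  have := congrArg Complex.normSq h
  rw [map_pow] at this
  rw [this]
  norm_num [Complex.normSq_apply]

theorem inv_eq_conj {z : ℂ} (h : Complex.normSq z = 1) : z * (starRingEnd ℂ) z = 1 := by
  rw [Complex.mul_conj, h, Complex.ofReal_one]

/-- A circle around the origin meets a circle with another centre in at most two points. -/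
theorem unit_circle_quadratic {a b t : ℂ} {R : ℝ} (ht : Complex.normSq t = 1)
    (h : Complex.normSq (a + b * t) = R) :
    a * (starRingEnd ℂ) b + t * (a * (starRingEnd ℂ) a + b * (starRingEnd ℂ) b - R) +
      t ^ 2 * ((starRingEnd ℂ) a * b) = 0 := by
  have h1 := inv_eq_conj ht
  have h2 : (a + b * t) * (starRingEnd ℂ) (a + b * t) = R := by rw [Complex.mul_conj, h]
  rw [map_add, map_mul] at h2
  -- On the unit circle the conjugate of `t` is `t⁻¹`. Multiplying the equation of the second circle
  -- by `t` makes it a quadratic polynomial in `t`.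
  linear_combination t * h2 - (a * (starRingEnd ℂ) b + b * (starRingEnd ℂ) b * t) * h1

theorem rep_ratio_eq {i j k : Fin 3} (hij : i ≠ j) (hik : i ≠ k) (hjk : j ≠ k) {s s' : P2}
    (hv : ∀ l, s.rep l ≠ 0) (hv' : ∀ l, s'.rep l ≠ 0)
    (h1 : s.rep j / s.rep i = s'.rep j / s'.rep i) (h2 : s.rep k / s.rep i = s'.rep k / s'.rep i) :
    s = s' := by
  have a1 := hv i
  have a2 := hv' i
  refine eq_of_rep (s.rep i / s'.rep i) (forall_of_ne hij hik hjk ?_ ?_ ?_)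
  · rw [div_mul_cancel₀ _ a2]
  · field_simp at h1 ⊢
    exact h1
  · field_simp at h2 ⊢
    exact h2

theorem line_eq_div {i j k : Fin 3} (hij : i ≠ j) (hik : i ≠ k) (hjk : j ≠ k) {a v : Fin 3 → ℂ}
    (hv : ∀ l, v l ≠ 0) (h : ∑ l, a l * v l = 0) :
    a i + a j * (v j / v i) + a k * (v k / v i) = 0 := by
  rw [sum_eq_of_ne hij hik hjk] at h
  have := hv i
  field_simp
  linear_combination h

/-- For points of type `k`, the ratio `t = v_j / v_i` has modulus one and `v_k / v_i` has constant
modulus. The line equation then puts `t` on the circle `|a_i + a_j t| = const`, whose centre is not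
`0`. As `a_k ≠ 0`, the point is determined by `t`. -/
theorem card_le_two_of_hasType {d : ℕ} (hd : d ≠ 0) {i j k : Fin 3} (hij : i ≠ j) (hik : i ≠ k)
    (hjk : j ≠ k) (S : Finset P2) (hv : ∀ s ∈ S, ∀ l, s.rep l ≠ 0) (a : Fin 3 → ℂ)
    (ha : ∀ l, a l ≠ 0) (hline : ∀ s ∈ S, ∑ l, a l * s.rep l = 0)
    (htype : ∀ s ∈ S, HasType d s.rep k) : S.card ≤ 2 := by
  by_contra! hcard
  obtain ⟨s, hs, t, ht, u, hu, hst, hsu, htu⟩ := Finset.two_lt_card.1 hcard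
  have hl := fun x hx => line_eq_div hij hik hjk (hv x hx) (hline x hx)
  have hr := fun x hx => (htype x hx).ratio hik hjk (hv x hx)
  have hdist : ∀ x ∈ S, ∀ y ∈ S, x ≠ y → x.rep j / x.rep i ≠ y.rep j / y.rep i := by
    intro x hx y hy hxy h
    refine hxy (rep_ratio_eq hij hik hjk (hv x hx) (hv y hy) h ?_)
    refine mul_left_cancel₀ (ha k) ?_
    linear_combination hl x hx - hl y hy - a j * h
  set R := Complex.normSq (a k) * Complex.normSq (s.rep k / s.rep i) with hR
  have hq : ∀ x ∈ S, Complex.normSq (a i + a j * (x.rep j / x.rep i)) = R := by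
    intro x hx
    have h1 : a i + a j * (x.rep j / x.rep i) = -(a k * (x.rep k / x.rep i)) := by
      linear_combination hl x hx
    rw [h1, Complex.normSq_neg, map_mul, hR]
    congr 1
    refine (pow_left_inj₀ (Complex.normSq_nonneg _) (Complex.normSq_nonneg _) hd).1 ?_
    rw [normSq_pow_of_pow (hr x hx).2, normSq_pow_of_pow (hr s hs).2]
  have hz := fun x hx => unit_circle_quadratic (normSq_eq_one_of_pow hd (hr x hx).1) (hq x hx)
  obtain ⟨-, -, h3⟩ := eq_zero_of_three_roots (hdist s hs t ht hst) (hdist s hs u hu hsu)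
    (hdist t ht u hu htu) (hz s hs) (hz t ht) (hz u hu)
  exact mul_ne_zero ((map_ne_zero _).2 (ha i)) (ha j) h3

/-- Normalized by `x_i = 1`, the two points are `(1, t, w)` and `(1, η t, ξ w)`. Eliminating `a_k`
or `a_j` from their line equations gives the two relations, and any equality among `1`, `ξ`, `η`
would make the points coincide. -/
theorem pair_relations {d : ℕ} {i j k : Fin 3} (hij : i ≠ j) (hik : i ≠ k)
    (hjk : j ≠ k) {a : Fin 3 → ℂ} (ha : ∀ l, a l ≠ 0) {s s' : P2} (hss : s ≠ s')
    (hv : ∀ l, s.rep l ≠ 0) (hv' : ∀ l, s'.rep l ≠ 0) (hs : ∑ l, a l * s.rep l = 0)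
    (hs' : ∑ l, a l * s'.rep l = 0) (ht : HasType d s.rep k) (ht' : HasType d s'.rep k) :
    ∃ t w ξ η : ℂ, t ^ d = 1 ∧ w ^ d = -2 ∧ ξ ^ d = 1 ∧ η ^ d = 1 ∧ ξ ≠ 1 ∧ η ≠ 1 ∧ η ≠ ξ ∧
      a i * (ξ - 1) = a j * t * (η - ξ) ∧ a i * (η - 1) = -a k * w * (η - ξ) := by
  have hl := line_eq_div hij hik hjk hv hs
  have hl' := line_eq_div hij hik hjk hv' hs'
  obtain ⟨e1, e2⟩ := ht.ratio hik hjk hv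
  obtain ⟨e3, e4⟩ := ht'.ratio hik hjk hv'
  have hdist := mt (rep_ratio_eq hij hik hjk hv hv' (s := s) (s' := s'))
  have ht0 : s.rep j / s.rep i ≠ 0 := div_ne_zero (hv j) (hv i)
  have hw0 : s.rep k / s.rep i ≠ 0 := div_ne_zero (hv k) (hv i)
  have hne : ¬(s.rep j / s.rep i = s'.rep j / s'.rep i ∧
      s.rep k / s.rep i = s'.rep k / s'.rep i) := fun h =>
    hss (rep_ratio_eq hij hik hjk hv hv' h.1 h.2)
  clear hdist
  generalize s.rep j / s.rep i = t at *
  generalize s.rep k / s.rep i = w at *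
  generalize s'.rep j / s'.rep i = t' at *
  generalize s'.rep k / s'.rep i = w' at *
  have hξ : w' = w * (w' / w) := by field_simp
  have hη : t' = t * (t' / t) := by field_simp
  refine ⟨t, w, w' / w, t' / t, e1, e2, ?_, ?_, ?_, ?_, ?_, ?_, ?_⟩
  · rw [div_pow, e4, e2]; norm_num
  · rw [div_pow, e3, e1]; norm_num
  · intro h
    rw [div_eq_one_iff_eq hw0] at h
    rw [h] at hl'
    refine hne ⟨mul_left_cancel₀ (ha j) ?_, h.symm⟩
    linear_combination hl - hl'
  · intro h
    rw [div_eq_one_iff_eq ht0] at h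
    rw [h] at hl'
    refine hne ⟨h.symm, mul_left_cancel₀ (ha k) ?_⟩
    linear_combination hl - hl'
  · intro h
    rw [h] at hη
    rw [hη] at hl'
    have h1 : a i * (w' / w - 1) = 0 := by
      rw [hξ] at hl'
      have : w * (w' / w) / w = w' / w := by field_simp
      rw [this] at hl'
      linear_combination (w' / w) * hl - hl'
    have h2 : w' / w = 1 := sub_eq_zero.1 ((mul_eq_zero.1 h1).resolve_left (ha i))
    rw [h2, mul_one] at hη hξ
    exact hne ⟨hη.symm, hξ.symm⟩
  · generalize w' / w = ξ at *
    generalize t' / t = η at *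
    rw [hξ, hη] at hl'
    linear_combination ξ * hl - hl'
  · generalize w' / w = ξ at *
    generalize t' / t = η at *
    rw [hξ, hη] at hl'
    linear_combination η * hl - hl'

theorem normSq_div_eq {d : ℕ} (hd : d ≠ 0) {ξ η : ℂ} (hξ : ξ ^ d = 1) (hη : η ^ d = 1)
    (hne : η ≠ ξ) : ∃ ζ : ℂ, ζ ^ d = 1 ∧ ζ ≠ 1 ∧ Complex.normSq (η - ξ) = Complex.normSq (1 - ζ) := by
  have hη0 : η ≠ 0 := by rintro rfl; simp [hd] at hη
  refine ⟨ξ / η, by rw [div_pow, hξ, hη, div_one], fun h => hne ?_, ?_⟩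
  · rw [div_eq_one_iff_eq hη0] at h
    exact h.symm
  · have : η - ξ = η * (1 - ξ / η) := by field_simp
    rw [this, map_mul, normSq_eq_one_of_pow hd hη, one_mul]

/-- Two pairs of points of different types on a line force a relation between the squared
distances of `d`-th roots of unity to `1`. -/
theorem exists_ratio_of_pairs {d : ℕ} (hd : d ≠ 0) {i j k : Fin 3} (hij : i ≠ j) (hik : i ≠ k)
    (hjk : j ≠ k) {a : Fin 3 → ℂ} (ha : ∀ l, a l ≠ 0) {s s' u u' : P2} (hss : s ≠ s')
    (huu : u ≠ u') (hvs : ∀ l, s.rep l ≠ 0) (hvs' : ∀ l, s'.rep l ≠ 0) (hvu : ∀ l, u.rep l ≠ 0)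
    (hvu' : ∀ l, u'.rep l ≠ 0) (hs : ∑ l, a l * s.rep l = 0) (hs' : ∑ l, a l * s'.rep l = 0)
    (hu : ∑ l, a l * u.rep l = 0) (hu' : ∑ l, a l * u'.rep l = 0)
    (hts : HasType d s.rep k) (hts' : HasType d s'.rep k)
    (htu : HasType d u.rep j) (htu' : HasType d u'.rep j) :
    ∃ (R : ℝ) (ζ₁ ζ₂ ζ₃ ζ₄ : ℂ), 0 ≤ R ∧ R ^ d = 4 ∧ (ζ₁ ^ d = 1 ∧ ζ₁ ≠ 1) ∧ (ζ₂ ^ d = 1 ∧ ζ₂ ≠ 1) ∧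
      (ζ₃ ^ d = 1 ∧ ζ₃ ≠ 1) ∧ (ζ₄ ^ d = 1 ∧ ζ₄ ≠ 1) ∧
      R * (Complex.normSq (1 - ζ₁) * Complex.normSq (1 - ζ₂)) =
        Complex.normSq (1 - ζ₃) * Complex.normSq (1 - ζ₄) := by
  obtain ⟨t, w, ξ, η, ht, hw, hξ, hη, hξ1, hη1, hηξ, h1, h2⟩ :=
    pair_relations hij hik hjk ha hss hvs hvs' hs hs' hts hts'
  obtain ⟨t', w', ξ', η', ht', hw', hξ', hη', hξ1', hη1', hηξ', h1', h2'⟩ :=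
    pair_relations hik hij hjk.symm ha huu hvu hvu' hu hu' htu htu'
  obtain ⟨ζ, hζ, hζ1, hζn⟩ := normSq_div_eq hd hξ hη hηξ
  obtain ⟨ζ', hζ', hζ1', hζn'⟩ := normSq_div_eq hd hξ' hη' hηξ'
  refine ⟨Complex.normSq w', ξ, ζ', ζ, η', Complex.normSq_nonneg _, normSq_pow_of_pow hw',
    ⟨hξ, hξ1⟩, ⟨hζ', hζ1'⟩, ⟨hζ, hζ1⟩, ⟨hη', hη1'⟩, ?_⟩
  -- The first pair gives `|a_i|² |1 - ξ|² = |a_j|² |1 - ζ|²`. The second, with `j` and `k`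
  -- exchanged, gives `|a_i|² |1 - η'|² = |a_j|² R |1 - ζ'|²`. The quotient no longer contains the
  -- line.
  have g1 := congrArg Complex.normSq h1
  have g2 := congrArg Complex.normSq h2'
  rw [map_mul, map_mul, map_mul, normSq_eq_one_of_pow hd ht, hζn, ← Complex.normSq_neg (ξ - 1),
    neg_sub] at g1
  rw [map_mul, map_mul, map_mul, Complex.normSq_neg, hζn', ← Complex.normSq_neg (η' - 1),
    neg_sub] at g2
  have hi := Complex.normSq_pos.2 (ha i)
  have hj := Complex.normSq_pos.2 (ha j)
  refine mul_left_cancel₀ (mul_pos hi hj).ne' ?_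
  linear_combination Complex.normSq (a j) * Complex.normSq w' * Complex.normSq (1 - ζ') * g1 -
    Complex.normSq (a j) * Complex.normSq (1 - ζ) * g2

/-- Both the conjugate and the inverse of `ζ` equal `ζ ^ d`, the order of `ζ` dividing `d + 1`. -/
theorem normSq_one_sub {d : ℕ} {ζ : ℂ} (hζ : ζ ^ (d + 1) = 1) :
    (Complex.normSq (1 - ζ) : ℂ) = 2 - ζ - ζ ^ d := by
  have h1 := inv_eq_conj (normSq_eq_one_of_pow (Nat.succ_ne_zero d) hζ)
  have hζ0 : ζ ≠ 0 := by rintro rfl; simp at h1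
  have h2 : (starRingEnd ℂ) ζ = ζ ^ d := mul_left_cancel₀ hζ0 (by rw [h1, ← pow_succ', hζ])
  rw [← Complex.mul_conj, map_sub, map_one, h2]
  linear_combination hζ

theorem normSq_fifth {ζ : ℂ} (hζ : ζ ^ 5 = 1) (hζ1 : ζ ≠ 1) :
    Complex.normSq (1 - ζ) ^ 2 - 5 * Complex.normSq (1 - ζ) + 5 = 0 := by
  have h := normSq_one_sub (d := 4) hζ
  have h0 : ζ ^ 4 + ζ ^ 3 + ζ ^ 2 + ζ + 1 = 0 :=
    mul_left_cancel₀ (sub_ne_zero.2 hζ1) (by linear_combination hζ)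
  have : ((Complex.normSq (1 - ζ) : ℂ)) ^ 2 - 5 * (Complex.normSq (1 - ζ) : ℂ) + 5 = 0 := by
    rw [h]
    linear_combination h0 + (ζ ^ 3 + 2) * hζ
  exact_mod_cast this

theorem normSq_sixth {ζ : ℂ} (hζ : ζ ^ 6 = 1) (hζ1 : ζ ≠ 1) :
    Complex.normSq (1 - ζ) = 1 ∨ Complex.normSq (1 - ζ) = 3 ∨ Complex.normSq (1 - ζ) = 4 := by
  have h := normSq_one_sub (d := 5) hζ
  have h0 : ζ ^ 5 + ζ ^ 4 + ζ ^ 3 + ζ ^ 2 + ζ + 1 = 0 :=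
    mul_left_cancel₀ (sub_ne_zero.2 hζ1) (by linear_combination hζ)
  have : ((Complex.normSq (1 - ζ) : ℂ) - 1) * (((Complex.normSq (1 - ζ) : ℂ)) - 3) *
      ((Complex.normSq (1 - ζ) : ℂ) - 4) = 0 := by
    rw [h]
    linear_combination (-2) * h0 + (-(ζ ^ 9) - ζ ^ 3 - 3 * ζ ^ 5 - 3 * ζ + -2 * ζ ^ 4 - 4) * hζ
  have : (Complex.normSq (1 - ζ) - 1) * (Complex.normSq (1 - ζ) - 3) *
      (Complex.normSq (1 - ζ) - 4) = 0 := by exact_mod_cast this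
  rcases mul_eq_zero.1 this with h | h
  · rcases mul_eq_zero.1 h with h | h
    · exact Or.inl (by linarith)
    · exact Or.inr (Or.inl (by linarith))
  · exact Or.inr (Or.inr (by linarith))

/-- The numbers `n_i` are `(5 ± √5) / 2`, so the products are about `13.1`, `5` and `1.9`. Ratios of
these that exceed `1` exceed `2`, whereas `R = 4 ^ (1 / 5)` lies strictly between `1` and `2`. -/
theorem false_of_ratio_five {R n₁ n₂ n₃ n₄ : ℝ} (hR0 : 0 ≤ R) (hR : R ^ 5 = 4)
    (h₁ : n₁ ^ 2 - 5 * n₁ + 5 = 0) (h₂ : n₂ ^ 2 - 5 * n₂ + 5 = 0) (h₃ : n₃ ^ 2 - 5 * n₃ + 5 = 0)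
    (h₄ : n₄ ^ 2 - 5 * n₄ + 5 = 0) (h : R * (n₁ * n₂) = n₃ * n₄) : False := by
  have hR1 : 1 < R := by
    by_contra! h
    have := pow_le_one₀ (n := 5) hR0 h
    linarith
  have hR2 : R < 2 := by
    by_contra! h
    have := pow_le_pow_left₀ (by norm_num) h 5
    norm_num at this
    linarith
  set p := (5 + √5) / 2 with hp
  set q := (5 - √5) / 2 with hq
  have h5 : √5 ^ 2 = 5 := Real.sq_sqrt (by norm_num)
  have h5a : 2.2 < √5 := Real.lt_sqrt_of_sq_lt (by norm_num)
  have h5b : √5 < 2.3 := (Real.sqrt_lt' (by norm_num)).2 (by norm_num)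
  have key : ∀ n : ℝ, n ^ 2 - 5 * n + 5 = 0 → n = p ∨ n = q := by
    intro n hn
    have : (n - p) * (n - q) = 0 := by
      rw [hp, hq]
      linear_combination hn - h5 / 4
    rcases mul_eq_zero.1 this with h | h
    · exact Or.inl (by linarith)
    · exact Or.inr (by linarith)
  have pp : p * p = (15 + 5 * √5) / 2 := by rw [hp]; linear_combination h5 / 4
  have pq : p * q = 5 := by rw [hp, hq]; linear_combination -h5 / 4
  have qp : q * p = 5 := by rw [mul_comm, pq]
  have qq : q * q = (15 - 5 * √5) / 2 := by rw [hq]; linear_combination h5 / 4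
  have hpos : 0 < n₁ * n₂ := by
    rcases key n₁ h₁ with rfl | rfl <;> rcases key n₂ h₂ with rfl | rfl <;>
    simp only [pp, pq, qp, qq] <;> linarith
  have hlt : n₁ * n₂ < n₃ * n₄ := by rw [← h]; nlinarith
  have hgt : n₃ * n₄ < 2 * (n₁ * n₂) := by rw [← h]; nlinarith
  rcases key n₁ h₁ with rfl | rfl <;> rcases key n₂ h₂ with rfl | rfl <;>
  rcases key n₃ h₃ with rfl | rfl <;> rcases key n₄ h₄ with rfl | rfl <;>
  simp only [pp, pq, qp, qq] at hlt hgt <;> linarith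

/-- The products lie in `{1, 3, 4, 9, 12, 16}`, where the smallest ratio above `1` is `4 / 3`, while
`1 < 4 ^ (1 / 6) < 4 / 3`. -/
theorem false_of_ratio_six {R n₁ n₂ n₃ n₄ : ℝ} (hR0 : 0 ≤ R) (hR : R ^ 6 = 4)
    (h₁ : n₁ = 1 ∨ n₁ = 3 ∨ n₁ = 4) (h₂ : n₂ = 1 ∨ n₂ = 3 ∨ n₂ = 4) (h₃ : n₃ = 1 ∨ n₃ = 3 ∨ n₃ = 4)
    (h₄ : n₄ = 1 ∨ n₄ = 3 ∨ n₄ = 4) (h : R * (n₁ * n₂) = n₃ * n₄) : False := by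
  have hR1 : 1 < R := by
    by_contra! h
    have := pow_le_one₀ (n := 6) hR0 h
    linarith
  have hR2 : R < 4 / 3 := by
    by_contra! h
    have := pow_le_pow_left₀ (by norm_num) h 6
    norm_num at this
    linarith
  have hpos : 0 < n₁ * n₂ := by
    rcases h₁ with rfl | rfl | rfl <;> rcases h₂ with rfl | rfl | rfl <;> norm_num
  have hlt : n₁ * n₂ < n₃ * n₄ := by rw [← h]; nlinarith
  have hgt : 3 * (n₃ * n₄) < 4 * (n₁ * n₂) := by rw [← h]; nlinarith
  clear h hpos
  rcases h₁ with rfl | rfl | rfl <;> rcases h₂ with rfl | rfl | rfl <;>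
  rcases h₃ with rfl | rfl | rfl <;> rcases h₄ with rfl | rfl | rfl <;> linarith

theorem mem_gaussian_of_pow_four {z : ℂ} (h : z ^ 4 = 1) : z ∈ GaussianInt.toComplex.range := by
  have hI : Complex.I ∈ GaussianInt.toComplex.range :=
    ⟨⟨0, 1⟩, by simp [GaussianInt.toComplex_def]⟩
  have h1 : (z - 1) * (z + 1) * ((z - Complex.I) * (z + Complex.I)) = 0 := by
    linear_combination h + (1 - z ^ 2) * Complex.I_sq
  rcases mul_eq_zero.1 h1 with h | h <;> rcases mul_eq_zero.1 h with h | h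
  · rw [sub_eq_zero.1 h]; exact one_mem _
  · rw [eq_neg_of_add_eq_zero_left h]; exact neg_mem (one_mem _)
  · rw [sub_eq_zero.1 h]; exact hI
  · rw [eq_neg_of_add_eq_zero_left h]; exact neg_mem hI

theorem exists_int_normSq {z : ℂ} (h : z ∈ GaussianInt.toComplex.range) :
    ∃ n : ℤ, Complex.normSq z = n := by
  obtain ⟨x, rfl⟩ := h
  exact ⟨x.norm, (GaussianInt.intCast_real_norm x).symm⟩

theorem exists_int_re_mul_conj {z w : ℂ} (hz : z ∈ GaussianInt.toComplex.range)
    (hw : w ∈ GaussianInt.toComplex.range) : ∃ n : ℤ, (z * (starRingEnd ℂ) w).re = n := by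
  obtain ⟨x, rfl⟩ := hz
  obtain ⟨y, rfl⟩ := hw
  refine ⟨(x * star y).re, ?_⟩
  rw [← GaussianInt.toComplex_star, ← map_mul, GaussianInt.intCast_re]

/-- A fourth root of `-2` is not a quotient of elements `√2 β + γ` and `α` with `α`, `β`, `γ`
Gaussian integers, `γ ≠ 0`. -/
theorem false_of_gaussian_relation {w α β γ : ℂ} (hw : w ^ 4 = -2)
    (hα : α ∈ GaussianInt.toComplex.range) (hβ : β ∈ GaussianInt.toComplex.range)
    (hγ : γ ∈ GaussianInt.toComplex.range) (hγ0 : γ ≠ 0)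
    (h : w * α = (√2 : ℝ) * β + γ) : False := by
  obtain ⟨A, hA⟩ := exists_int_normSq hα
  obtain ⟨B, hB⟩ := exists_int_normSq hβ
  obtain ⟨G, hG⟩ := exists_int_normSq hγ
  obtain ⟨M, hM⟩ := exists_int_re_mul_conj hβ hγ
  have hs : (√2 : ℝ) ^ 2 = 2 := Real.sq_sqrt (by norm_num)
  have hnw : Complex.normSq w = √2 := by
    refine (pow_left_inj₀ (Complex.normSq_nonneg _) (Real.sqrt_nonneg _) four_ne_zero).1 ?_
    rw [normSq_pow_of_pow hw]
    linear_combination -(√2 ^ 2 + 2) * hs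
  have hre : ((√2 : ℝ) * β * (starRingEnd ℂ) γ : ℂ).re = √2 * M := by
    rw [mul_assoc, Complex.re_ofReal_mul, hM]
  -- As `|w|² = √2`, taking squared absolute values gives `√2 * A = 2 * B + G + 2 * √2 * M` with
  -- integers `A, B, G, M`. Since `2 * B + G > 0`, this would make `√2` rational.
  have hn := congrArg Complex.normSq h
  rw [map_mul, hnw, hA, Complex.normSq_add, map_mul, Complex.normSq_ofReal, hB, hG,
    hre] at hn
  have hGpos : 0 < (G : ℝ) := hG ▸ Complex.normSq_pos.2 hγ0
  have hBnn : 0 ≤ (B : ℝ) := hB ▸ Complex.normSq_nonneg β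
  have hrel : √2 * ((A - 2 * M : ℤ) : ℝ) = ((2 * B + G : ℤ) : ℝ) := by
    push_cast
    linear_combination hn + B * hs
  have hne : ((A - 2 * M : ℤ) : ℝ) ≠ 0 := by
    intro h0
    rw [h0, mul_zero] at hrel
    push_cast at hrel
    linarith
  refine irrational_sqrt_two ⟨((2 * B + G : ℤ) : ℚ) / ((A - 2 * M : ℤ) : ℚ), ?_⟩
  rw [Rat.cast_div, Rat.cast_intCast, Rat.cast_intCast, ← hrel, mul_div_cancel_right₀ _ hne]

/-- For `d = 4` two points of one type and a single point of another suffice. Eliminating `a` from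
their equations leaves a relation between `w`, fourth roots of unity and the product `w * T`, where
`T ^ 4 = w ^ 4 = -2`. Both `T / w` and `w² / √2` are fourth roots of unity, so `w * T` is `√2` times
a Gaussian unit. -/
theorem false_of_pair_of_four {i j k : Fin 3} (hij : i ≠ j) (hik : i ≠ k) (hjk : j ≠ k)
    {a : Fin 3 → ℂ} (ha : ∀ l, a l ≠ 0) {s s' u : P2} (hss : s ≠ s')
    (hvs : ∀ l, s.rep l ≠ 0) (hvs' : ∀ l, s'.rep l ≠ 0) (hvu : ∀ l, u.rep l ≠ 0)
    (hs : ∑ l, a l * s.rep l = 0) (hs' : ∑ l, a l * s'.rep l = 0)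
    (hu : ∑ l, a l * u.rep l = 0) (hts : HasType 4 s.rep k) (hts' : HasType 4 s'.rep k)
    (htu : HasType 4 u.rep j) : False := by
  obtain ⟨t, w, ξ, η, ht, hw, hξ, hη, hξ1, hη1, hηξ, h1, h2⟩ :=
    pair_relations hij hik hjk ha hss hvs hvs' hs hs' hts hts'
  obtain ⟨hW, hT⟩ := htu.ratio hij hjk.symm hvu
  have hline := line_eq_div hij hik hjk hvu hu
  generalize u.rep k / u.rep i = W at *
  generalize u.rep j / u.rep i = T at *
  have hw0 : w ≠ 0 := by rintro rfl; norm_num at hw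
  have ht0 : t ≠ 0 := by rintro rfl; norm_num at ht
  have hW0 : W ≠ 0 := by rintro rfl; norm_num at hW
  have hs2 : ((√2 : ℝ) : ℂ) ^ 2 = 2 := by
    rw [← Complex.ofReal_pow, Real.sq_sqrt (by norm_num)]
    norm_num
  have hs0 : ((√2 : ℝ) : ℂ) ≠ 0 := fun h => by rw [h] at hs2; norm_num at hs2
  have hε : (T / w) ^ 4 = 1 := by rw [div_pow, hT, hw]; norm_num
  have hg : (w ^ 2 / (√2 : ℝ)) ^ 4 = 1 := by
    rw [div_pow, ← pow_mul, show 2 * 4 = 4 * 2 by norm_num, pow_mul, hw,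
      show (((√2 : ℝ) : ℂ)) ^ 4 = ((((√2 : ℝ) : ℂ)) ^ 2) ^ 2 by ring, hs2]
    norm_num
  have hrel : w * ((η - ξ) * t) =
      (√2 : ℝ) * (-(w ^ 2 / (√2 : ℝ)) * (ξ - 1) * (T / w)) + (η - 1) * W * t := by
    field_simp
    refine mul_left_cancel₀ (ha i) ?_
    linear_combination w * t * (η - ξ) * hline - w * T * h1 * (-1) - t * W * h2
  have m1 := mem_gaussian_of_pow_four ht
  have m2 := mem_gaussian_of_pow_four hξ
  have m3 := mem_gaussian_of_pow_four hη
  have m4 := mem_gaussian_of_pow_four hW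
  have m5 := mem_gaussian_of_pow_four hε
  have m6 := mem_gaussian_of_pow_four hg
  exact false_of_gaussian_relation hw (mul_mem (sub_mem m3 m2) m1)
    (mul_mem (mul_mem (neg_mem m6) (sub_mem m2 (one_mem _))) m5)
    (mul_mem (mul_mem (sub_mem m3 (one_mem _)) m4) m1)
    (mul_ne_zero (mul_ne_zero (sub_ne_zero.2 hη1) hW0) ht0) hrel

theorem exists_third {j k : Fin 3} (hjk : j ≠ k) : ∃ i : Fin 3, i ≠ j ∧ i ≠ k := by
  revert j k; decide

/-- A line that contains `d` sextactic points passes through a vertex of the coordinate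
triangle. -/
theorem exists_coeff_eq_zero {d : ℕ} (hd : 3 < d) (S : Finset P2) (hcard : S.card = d)
    (hsext : ∀ s ∈ S, IsSextacticPoint (fermatCurve d) s) (a : Fin 3 → ℂ)
    (hline : ∀ s ∈ S, ∑ l, a l * s.rep l = 0) : ∃ l, a l = 0 := by
  classical
  by_contra! ha
  have hd0 : d ≠ 0 := by omega
  have hv : ∀ s ∈ S, ∀ l, s.rep l ≠ 0 := fun s hs => (hsext s hs).rep_ne_zero hd
  set F : Fin 3 → Finset P2 := fun k => S.filter fun s => HasType d s.rep k with hF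
  have hmem : ∀ k s, s ∈ F k ↔ s ∈ S ∧ HasType d s.rep k := fun k s => by simp [hF]
  have hle : ∀ k, (F k).card ≤ 2 := by
    intro k
    obtain ⟨j, hjk, -⟩ := exists_third (j := k) (k := k + 1) (by revert k; decide)
    obtain ⟨i, hij, hik⟩ := exists_third hjk
    exact card_le_two_of_hasType hd0 hij hik hjk _ (fun s hs => hv s ((hmem k s).1 hs).1) a ha
      (fun s hs => hline s ((hmem k s).1 hs).1) fun s hs => ((hmem k s).1 hs).2
  have hsub : S ⊆ F 0 ∪ (F 1 ∪ F 2) := by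
    intro s hs
    obtain ⟨k, hk⟩ := (hsext s hs).exists_hasType hd
    simp only [Finset.mem_union]
    fin_cases k
    · exact Or.inl ((hmem 0 s).2 ⟨hs, hk⟩)
    · exact Or.inr (Or.inl ((hmem 1 s).2 ⟨hs, hk⟩))
    · exact Or.inr (Or.inr ((hmem 2 s).2 ⟨hs, hk⟩))
  have hsum : d ≤ (F 0).card + ((F 1).card + (F 2).card) := by
    rw [← hcard]
    exact (Finset.card_le_card hsub).trans ((Finset.card_union_le _ _).trans
      (Nat.add_le_add_left (Finset.card_union_le _ _) _))
  have l0 := hle 0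
  have l1 := hle 1
  have l2 := hle 2
  -- At most two points of each of three types leave `d = 4, 5, 6`. For `d ≥ 5` two types have two
  -- points each. For `d = 4` it is only used that one type has two points and another at least one.
  by_cases h4 : d = 4
  · obtain ⟨k, j, hjk, h2, h1⟩ : ∃ k j : Fin 3, j ≠ k ∧ 1 < (F k).card ∧ 0 < (F j).card := by
      rcases (by omega : (1 < (F 0).card ∧ 0 < (F 1).card) ∨ (1 < (F 0).card ∧ 0 < (F 2).card) ∨
        (1 < (F 1).card ∧ 0 < (F 0).card) ∨ (1 < (F 1).card ∧ 0 < (F 2).card) ∨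
        (1 < (F 2).card ∧ 0 < (F 0).card) ∨ (1 < (F 2).card ∧ 0 < (F 1).card))
        with h | h | h | h | h | h
      exacts [⟨0, 1, by decide, h⟩, ⟨0, 2, by decide, h⟩, ⟨1, 0, by decide, h⟩,
        ⟨1, 2, by decide, h⟩, ⟨2, 0, by decide, h⟩, ⟨2, 1, by decide, h⟩]
    obtain ⟨s, hs, s', hs', hss⟩ := Finset.one_lt_card.1 h2
    obtain ⟨u, hu⟩ := Finset.card_pos.1 h1
    obtain ⟨i, hij, hik⟩ := exists_third hjk
    rw [hmem] at hs hs' hu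
    subst h4
    exact false_of_pair_of_four hij hik hjk ha hss (hv s hs.1) (hv s' hs'.1) (hv u hu.1)
      (hline s hs.1) (hline s' hs'.1) (hline u hu.1) hs.2 hs'.2 hu.2
  · obtain ⟨k, j, hjk, h2, h1⟩ : ∃ k j : Fin 3, j ≠ k ∧ 1 < (F k).card ∧ 1 < (F j).card := by
      rcases (by omega : (1 < (F 0).card ∧ 1 < (F 1).card) ∨ (1 < (F 0).card ∧ 1 < (F 2).card) ∨
        (1 < (F 1).card ∧ 1 < (F 2).card)) with h | h | h
      exacts [⟨0, 1, by decide, h⟩, ⟨0, 2, by decide, h⟩, ⟨1, 2, by decide, h⟩]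
    obtain ⟨s, hs, s', hs', hss⟩ := Finset.one_lt_card.1 h2
    obtain ⟨u, hu, u', hu', huu⟩ := Finset.one_lt_card.1 h1
    obtain ⟨i, hij, hik⟩ := exists_third hjk
    rw [hmem] at hs hs' hu hu'
    obtain ⟨R, ζ₁, ζ₂, ζ₃, ζ₄, hR0, hR, ⟨e1, f1⟩, ⟨e2, f2⟩, ⟨e3, f3⟩, ⟨e4, f4⟩, hrel⟩ :=
      exists_ratio_of_pairs hd0 hij hik hjk ha hss huu (hv s hs.1) (hv s' hs'.1) (hv u hu.1)
        (hv u' hu'.1) (hline s hs.1) (hline s' hs'.1) (hline u hu.1) (hline u' hu'.1) hs.2 hs'.2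
        hu.2 hu'.2
    rcases (by omega : d = 5 ∨ d = 6) with h | h
    · subst h
      exact false_of_ratio_five hR0 hR (normSq_fifth e1 f1) (normSq_fifth e2 f2)
        (normSq_fifth e3 f3) (normSq_fifth e4 f4) hrel
    · subst h
      exact false_of_ratio_six hR0 hR (normSq_sixth e1 f1) (normSq_sixth e2 f2)
        (normSq_sixth e3 f3) (normSq_sixth e4 f4) hrel

/-- A line that contains `d` sextactic points has an equation `y = t x`. -/
theorem exists_eq_mul {d : ℕ} (hd : 3 < d) (S : Finset P2) (hcard : S.card = d)
    (hsext : ∀ s ∈ S, IsSextacticPoint (fermatCurve d) s) (L : PlaneCurve 1)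
    (hL : ∀ s ∈ S, s ∈ L.points) :
    ∃ (i j k : Fin 3) (t : ℂ), i ≠ j ∧ i ≠ k ∧ j ≠ k ∧ ∀ s ∈ S, s.rep j = t * s.rep i := by
  have hv : ∀ s ∈ S, ∀ l, s.rep l ≠ 0 := fun s hs => (hsext s hs).rep_ne_zero hd
  obtain ⟨a, b, c, hf⟩ := exists_linear_coeffs (i := 0) (j := 1) (k := 2) (by decide) (by decide)
    (by decide) L.isHomogeneous_form
  have hform : L.form = ∑ l, C (![a, b, c] l) * X l := by
    rw [hf, Fin.sum_univ_three]
    rfl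
  generalize ![a, b, c] = e at hform
  have hline : ∀ s ∈ S, ∑ l, e l * s.rep l = 0 := by
    intro s hs
    have := hL s hs
    rw [PlaneCurve.points, Set.mem_ofPred_eq, hform, map_sum] at this
    simpa using this
  obtain ⟨k, hk⟩ := exists_coeff_eq_zero hd S hcard hsext e hline
  obtain ⟨i, hik, -⟩ := exists_third (j := k) (k := k + 1) (by clear hk; revert k; decide)
  obtain ⟨j, hji, hjk⟩ := exists_third hik
  obtain ⟨s₀, hs₀⟩ := Finset.card_pos.1 (by omega : 0 < S.card)
  have hline' : ∀ s ∈ S, e i * s.rep i + e j * s.rep j = 0 := by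
    intro s hs
    have := hline s hs
    rwa [sum_eq_of_ne hji.symm hik hjk, hk, zero_mul, add_zero] at this
  -- With two zero coefficients the third one would vanish as well, since sextactic points have no
  -- zero coordinate.
  have hj : e j ≠ 0 := by
    intro hj
    have h0 := hline' s₀ hs₀
    rw [hj, zero_mul, add_zero] at h0
    have hi := (mul_eq_zero.1 h0).resolve_right (hv s₀ hs₀ i)
    apply L.form_ne_zero
    rw [hform, sum_eq_of_ne hji.symm hik hjk, hi, hj, hk]
    simp
  refine ⟨i, j, k, -e i / e j, hji.symm, hik, hjk, fun s hs => ?_⟩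
  field_simp
  linear_combination hline' s hs

/-! ### Existence and uniqueness of the osculating curves, and the theorem -/

theorem existsUnique_isTangentLine {d : ℕ} (hd : 3 < d) {s : P2}
    (h : IsSextacticPoint (fermatCurve d) s) :
    ∃! T : PlaneCurve 1, IsTangentLine (fermatCurve d) s T := by
  have hs := h.sum_rep_pow
  have hv := h.rep_ne_zero hd
  have hd0 : d ≠ 0 := by omega
  set f : homogeneousSubmodule (Fin 3) ℂ 1 := ⟨∑ j, C (s.rep j ^ d * (s.rep j)⁻¹) * X j,
    (mem_homogeneousSubmodule _ _).2 (IsHomogeneous.sum _ _ _ fun _ _ =>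
      isHomogeneous_C_mul_X _ _)⟩ with hf
  have hf0 : f ≠ 0 := by
    intro h
    have h1 : ∑ j, C (s.rep j ^ d * (s.rep j)⁻¹) * X j = (0 : MvPolynomial (Fin 3) ℂ) :=
      congrArg Subtype.val h
    have h2 := congrArg (eval (fun l => if l = 0 then (1 : ℂ) else 0)) h1
    simp [hv 0] at h2
  obtain ⟨a, ha, hform⟩ := PlaneCurve.exists_form_mk f hf0
  have hmk : IsTangentLine (fermatCurve d) s (Projectivization.mk ℂ f hf0) :=
    (isTangentLine_iff hd0 _ s hs hv).2 ⟨a, hform⟩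
  refine ⟨_, hmk, fun T hT => ?_⟩
  obtain ⟨κ, hκ⟩ := (isTangentLine_iff hd0 T s hs hv).1 hT
  refine T.eq_of_form _ (κ * a⁻¹) ?_
  rw [hκ, hform, ← mul_assoc, ← C_mul, inv_mul_cancel_right₀ ha]

theorem existsUnique_isHyperosculatingConic {d : ℕ} (hd : 3 < d) {s : P2}
    (h : IsSextacticPoint (fermatCurve d) s) :
    ∃! O : PlaneCurve 2, IsHyperosculatingConic (fermatCurve d) s O := by
  have hs := h.sum_rep_pow
  have hv := h.rep_ne_zero hd
  obtain ⟨k, hk⟩ := h.exists_hasType hd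
  obtain ⟨i, hik, -⟩ := exists_third (j := k) (k := k + 1) (by clear hk; revert k; decide)
  obtain ⟨j, hji, hjk⟩ := exists_third hik
  have hpow : s.rep i ^ d = s.rep j ^ d := by linear_combination (hk i hik - hk j hjk) / 2
  obtain ⟨O, hO⟩ := h.2.2
  obtain ⟨κ, hκ, hf⟩ := exists_form_eq_sextacticForm hd O s hs hv hO hji.symm hik hjk hpow
  refine ⟨O, hO, fun O' hO' => ?_⟩
  obtain ⟨κ', hκ', hf'⟩ := exists_form_eq_sextacticForm hd O' s hs hv hO' hji.symm hik hjk hpow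
  refine O'.eq_of_form _ (κ' * κ⁻¹) ?_
  rw [hf, hf', ← mul_assoc, ← C_mul, inv_mul_cancel_right₀ hκ]

end FermatOsculation

open FermatOsculation

theorem theorem1p1 (d : ℕ) (hd : 3 < d) (S : Finset P2) (hcard : S.card = d)
    (hsext : ∀ s ∈ S, IsSextacticPoint (fermatCurve d) s)
    (hcol : ∃ L : PlaneCurve 1, ∀ s ∈ S, s ∈ L.points) :
    (∀ s ∈ S, ∃! T : PlaneCurve 1, IsTangentLine (fermatCurve d) s T) ∧
    (∀ s ∈ S, ∃! O : PlaneCurve 2, IsHyperosculatingConic (fermatCurve d) s O) ∧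
    (∀ T : P2 → PlaneCurve 1, (∀ s ∈ S, IsTangentLine (fermatCurve d) s (T s)) →
      ∃ q : P2, (⋂ s ∈ S, (T s).points) = {q} ∧
        IsFoldPoint d (⋃ s ∈ S, (T s).points) q) ∧
    (∀ O : P2 → PlaneCurve 2, (∀ s ∈ S, IsHyperosculatingConic (fermatCurve d) s (O s)) →
      ∃ q₁ q₂ : P2, q₁ ≠ q₂ ∧ (⋂ s ∈ S, (O s).points) = {q₁, q₂} ∧
        IsFoldPoint d (⋃ s ∈ S, (O s).points) q₁ ∧
        IsFoldPoint d (⋃ s ∈ S, (O s).points) q₂) := by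
  obtain ⟨L, hL⟩ := hcol
  obtain ⟨i, j, k, t, hij, hik, hjk, ht⟩ := exists_eq_mul hd S hcard hsext L hL
  have hS : 2 < S.card := by omega
  refine ⟨fun s hs => existsUnique_isTangentLine hd (hsext s hs),
    fun s hs => existsUnique_isHyperosculatingConic hd (hsext s hs), fun T hT => ?_,
    fun O hO => ?_⟩
  · have := tangent_conclusion hd hij hik hjk S hS hsext t ht T hT
    rwa [hcard] at this
  · have := conic_conclusion hd hij hik hjk S hS hsext t ht O hO
    rwa [hcard] at this
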